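/- For $n\ge 3$ let $G_n^2$ be the $2\times n$ grid graph with one additional vertex attached by an edge to one corner. For a finite simple graph $G$ let $X(G)$ be the graph obtained by replacing each vertex $v$ of degree $d$ by a gadget consisting of the tuples in $\{0,1\}^d$ (components indexed by the edges incident to $v$) with an even number of ones, without edges inside a gadget, and by joining, for each edge $e=\{u,v\}$ of $G$, a vertex of the gadget of $u$ to a vertex of the gadget of $v$ if and only if their components belonging to $e$ agree. Let $\tilde X(G)$ be obtained from $X(G)$ by choosing an edge $\{u,v\}$ of $G$ arbitrarily and interchanging edges and non-edges between the gadgets of $u$ and $v$. For a finite set $V$, a colouring $\chi$ of $V^2$ and $k\ge 2$, the $k$-walk refinement of $\chi$ assigns to $(u,v)$ the multiset, over all $(w_1,\dots,w_{k-1})\in V^{k-1}$, of the tuples $(\chi(u,w_1),\chi(w_1,w_2),\dots,\chi(w_{k-1},v))$. The walk refinement of $\chi$ is its $k$-walk refinement for the smallest $k\ge2$ for which the induced partition of $V^2$ is finest among all $j$-walk refinements, $j\ge 2$. On a graph one starts with the colouring that is $-1$ on pairs $(v,v)$, $1$ on edges and $0$ on other pairs, and iterates. Two graphs are distinguished in $m$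 iterations if the multisets of colours of all vertex pairs after $m$ iterations differ. The iteration number of a graph is the smallest $m$ such that $m$ and $m+1$ iterations induce the same partition of the vertex pairs. Then there are constants $c,C>0$ such that for all $n\ge 3$ and every choice of the twisted edge: 1. the graphs $X(G_n^2)$ and $\tilde X(G_n^2)$ have at least $cn$ and at most $Cn$ vertices; 2. walk refinement distinguishes $X(G_n^2)$ from $\tilde X(G_n^2)$ in some number of iterations, and every $m$ such that it distinguishes them in $m$ iterations satisfies $m\ge cn$; also for every fixed $k\ge 2$ (one common walk length for both graphs), $k$-walk refinement distinguishes them in $m$ iterations only if $m\ge cn$; 3. in particular, the iteration number of walk refinement on each of $X(G_n^2)$ and $\tilde X(G_n^2)$ is at least $cn$, and also at least $c$ times the number of vertices, so an upper bound linear in the number of vertices is optimal up to a constant factor. -/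

import Mathlib

namespace WalkRef

/-! ### Colourings of vertex pairs and their partitions -/

/-- The partition of the vertex pairs induced by `χ` is finer than (or equal to) the one
induced by `χ'`. -/
def Finer {V C C' : Type} (χ : V → V → C) (χ' : V → V → C') : Prop :=
  ∀ u₁ v₁ u₂ v₂ : V, χ u₁ v₁ = χ u₂ v₂ → χ' u₁ v₁ = χ' u₂ v₂

/-- Two colourings induce the same partition of the vertex pairs. -/
def SamePartition {V C C' : Type} (χ : V → V → C) (χ' : V → V → C') : Prop :=
  Finer χ χ' ∧ Finer χ' χ

/-- The colour `(χ(v₁,v₂), χ(v₂,v₃), …)` of a tuple of vertices `(v₁, v₂, …)`. -/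
def walkColour {V C : Type} (χ : V → V → C) : List V → List C
  | [] => []
  | [_] => []
  | u :: v :: l => χ u v :: walkColour χ (v :: l)

/-- Operators turning a colouring of the pairs of a finite set `V` with colours in `C` into a
colouring whose colours are multisets of tuples over `C`. All refinements below have this form. -/
abbrev ColouringOperator : Type 1 :=
  ∀ (V : Type) [Fintype V] (C : Type), (V → V → C) → V → V → Multiset (List C)

/-- The `k`-walk refinement (`k ≥ 2`): the pair `(u, v)` gets the multiset of the colours of all
walks `(u, w₁, …, w_{k-1}, v)`. -/
def kWalkRefinement (k : ℕ) : ColouringOperator := fun V _ _ χ u v =>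
  (Finset.univ : Finset (Fin (k - 1) → V)).val.map
    fun w => walkColour χ (u :: (List.ofFn w ++ [v]))

/-- The smallest `k ≥ 2` such that the `k`-walk refinement of `χ` induces the finest partition
among all `j`-walk refinements of `χ`, `j ≥ 2`. -/
noncomputable def walkLength {V : Type} [Fintype V] {C : Type} (χ : V → V → C) : ℕ :=
  sInf {k : ℕ | 2 ≤ k ∧ ∀ j : ℕ, 2 ≤ j →
    Finer (kWalkRefinement k V C χ) (kWalkRefinement j V C χ)}

/-- The walk refinement: the finest `k`-walk refinement. -/
noncomputable def walkRefinement : ColouringOperator := fun V _ C χ =>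
  kWalkRefinement (walkLength χ) V C χ

/-- The colours that occur after `m` iterations. -/
def IterColour (C : Type) : ℕ → Type
  | 0 => C
  | m + 1 => Multiset (List (IterColour C m))

/-- `m` iterations of the operator `r`, started with the colouring `χ`. -/
def iterate (r : ColouringOperator) {V : Type} [Fintype V] {C : Type} (χ : V → V → C) :
    (m : ℕ) → V → V → IterColour C m
  | 0 => χ
  | m + 1 => r V (IterColour C m) (iterate r χ m)

/-- The multiset of the colours of all vertex pairs. -/
def pairColours {V : Type} [Fintype V] {C : Type} (χ : V → V → C) : Multiset C :=
  (Finset.univ : Finset (V × V)).val.map fun q => χ q.1 q.2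

/-! ### Refining undirected graphs -/

open Classical in
/-- The initial colouring of a graph: `-1` on loops, `1` on edges, `0` on non-edges. -/
noncomputable def initialColouring {V : Type} (H : SimpleGraph V) (u v : V) : ℤ :=
  if u = v then -1 else if H.Adj u v then 1 else 0

/-- `r` distinguishes `H` and `H'` in `m` iterations. -/
def DistinguishesIn (r : ColouringOperator) (m : ℕ) {V V' : Type} [Fintype V] [Fintype V']
    (H : SimpleGraph V) (H' : SimpleGraph V') : Prop :=
  pairColours (iterate r (initialColouring H) m) ≠ pairColours (iterate r (initialColouring H') m)

/-- The number of iterations of `r` after which the partition of the vertex pairs of `H` is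
stable: the smallest `m` such that `m` and `m + 1` iterations induce the same partition. -/
noncomputable def iterationNumber (r : ColouringOperator) {V : Type} [Fintype V]
    (H : SimpleGraph V) : ℕ :=
  sInf {m : ℕ | SamePartition (iterate r (initialColouring H) m)
    (iterate r (initialColouring H) (m + 1))}

/-! ### The gadget construction -/

section CFI

variable {B : Type} [Fintype B] [DecidableEq B] (G : SimpleGraph B) [DecidableRel G.Adj]

/-- The gadget of a base vertex `v`: all `0`-`1`-tuples, indexed by the base edges incident to
`v` (given by their other endpoints), with an even number of ones. -/
abbrev Gadget (v : B) : Type :=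
  {a : G.neighborSet v → Bool // Even (Finset.univ.filter fun w => a w = true).card}

/-- The vertices obtained by replacing every base vertex with its gadget. -/
abbrev CFIVertex : Type := Σ v : B, Gadget G v

/-- The graph `X(G)`: vertices of the gadgets of two adjacent base vertices `u`, `v` are adjacent
if and only if they agree on the component belonging to the base edge `{u, v}`. -/
def cfi : SimpleGraph (CFIVertex G) where
  Adj x y := ∃ h : G.Adj x.1 y.1, x.2.1 ⟨y.1, h⟩ = y.2.1 ⟨x.1, h.symm⟩
  symm := ⟨fun _ _ ⟨h, e⟩ => ⟨h.symm, e.symm⟩⟩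
  loopless := ⟨fun _ ⟨h, _⟩ => G.loopless.irrefl _ h⟩

/-- The graph `X̃(G)`, with the base edge `e` twisted: between the gadgets of the two endpoints
of `e` edges and non-edges of `X(G)` are interchanged. -/
def cfiTwisted (e : G.edgeSet) : SimpleGraph (CFIVertex G) where
  Adj x y := ((cfi G).Adj x y ∧ s(x.1, y.1) ≠ e.1) ∨ (¬ (cfi G).Adj x y ∧ s(x.1, y.1) = e.1)
  symm := ⟨fun x y h => by rwa [(cfi G).adj_comm, Sym2.eq_swap] at h⟩
  loopless := ⟨fun x h => by
    rcases h with h | h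
    · exact (cfi G).loopless.irrefl x h.1
    · have he : s(x.1, x.1) ∈ G.edgeSet := h.2 ▸ e.2
      exact G.loopless.irrefl x.1 he⟩

end CFI

/-! ### The base graph -/

/-- Adjacency in the base graph: the `2 × n` grid on `Fin 2 × Fin n`, and the additional vertex
`none`, adjacent only to the corner in row `0` of the last column. -/
def baseAdj (n : ℕ) : Option (Fin 2 × Fin n) → Option (Fin 2 × Fin n) → Prop
  | some p, some q =>
      (p.1 ≠ q.1 ∧ p.2 = q.2) ∨
      (p.1 = q.1 ∧ (p.2.val + 1 = q.2.val ∨ q.2.val + 1 = p.2.val))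
  | some p, none => p.1 = 0 ∧ p.2.val + 1 = n
  | none, some p => p.1 = 0 ∧ p.2.val + 1 = n
  | none, none => False

instance (n : ℕ) : DecidableRel (baseAdj n) := fun x y => by
  rcases x with _ | p <;> rcases y with _ | q <;> unfold baseAdj <;> infer_instance

/-- The `2 × n` grid with an additional vertex attached to one corner. -/
def baseGraph (n : ℕ) : SimpleGraph (Option (Fin 2 × Fin n)) where
  Adj := baseAdj n
  symm := ⟨by
    rintro (_ | p) (_ | q) h
    · exact h
    · exact h
    · exact h
    · rcases h with ⟨h1, h2⟩ | ⟨h1, h2⟩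
      · exact Or.inl ⟨h1.symm, h2.symm⟩
      · exact Or.inr ⟨h1.symm, h2.symm⟩⟩
  loopless := ⟨by
    rintro (_ | p) h
    · exact h
    · rcases h with ⟨h1, -⟩ | ⟨-, h2 | h2⟩
      · exact h1 rfl
      · omega
      · omega⟩

instance (n : ℕ) : DecidableRel (baseGraph n).Adj :=
  inferInstanceAs (DecidableRel (baseAdj n))

end WalkRef

namespace WalkRef

/-! ### Walk refinements of abstract colourings -/

section Abstract

variable {V V' C C' : Type} [Fintype V] [Fintype V']

/-! Lower bound. A `Switching` flips an even set of components in each gadget. It would be an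
isomorphism from the untwisted to the twisted graph if its flips accounted for the twist on every
base edge; it can be made wrong on just one base edge. Flipping two components at a base vertex `y`
moves this error from one edge at `y` to another (`moves_of_adj`), so colours of a pair are
preserved as long as the error can be kept off the edge between its two gadgets. Within one
iteration walks of every length have to be matched, but at each step only the current base vertex,
the next one and the endpoint `q` matter: an error on a four-cycle avoiding `q` can dodge each step
without leaving the cycle (`kWalkRefinement_act`, `evades_fourCycle`). Only when a new iteration
starts with `q` on the current cell must the error escape, to a cell at most two columns away
(`innerCell_step`). Hence `4 * m + 2 ≤ n` rules out distinction in `m` iterations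
(`not_distinguishesIn_of_le`), regardless of the walk length.

Distinction. If the colouring of one graph is stable after `m` iterations and the graphs are not
distinguished after `m + 1`, the colours form a `StablePair`. In such a pair, degrees recognize the
gadget of the pendant vertex, then the last column, then column after column towards the left
(`TwistPair.grid`). Sweeping a pair of vertices through the columns accumulates the twists met so
far (`compDiff_column`); at the pendant vertex, whose gadget is a single tuple, their total must
vanish (`TwistPair.twistSum_eq_zero`), whereas a single twisted edge contributes exactly one
(`twistSum_edgeIndicator`).

Iteration number. By the second part, stability after `m` iterations forces distinction after `m +
1`, so the first part bounds the iteration number from below (`iterationNumber_bound`). -/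

theorem kWalkRefinement_one (χ : V → V → C) (u v : V) :
    kWalkRefinement 1 V C χ u v = {[χ u v]} := by
  simp [kWalkRefinement, walkColour]

theorem kWalkRefinement_succ (k : ℕ) (χ : V → V → C) (u v : V) :
    kWalkRefinement (k + 2) V C χ u v =
      (Finset.univ : Finset V).val.bind fun w =>
        (kWalkRefinement (k + 1) V C χ w v).map (List.cons (χ u w)) := by
  have h : (Finset.univ : Finset (Fin (k + 1) → V)).val =
      (Finset.univ : Finset (V × (Fin k → V))).val.map (Fin.consEquiv fun _ => V) := by
    rw [← Finset.map_univ_equiv (Fin.consEquiv fun _ => V), Finset.map_val]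
    rfl
  change (Finset.univ : Finset (Fin (k + 1) → V)).val.map _ = _
  rw [h, Multiset.map_map, ← Finset.univ_product_univ, Finset.product_val]
  change ((Finset.univ : Finset V).val.bind fun a =>
    (Finset.univ : Finset (Fin k → V)).val.map (Prod.mk a)).map _ = _
  rw [Multiset.map_bind]
  refine Multiset.bind_congr fun w _ => ?_
  change _ = ((Finset.univ : Finset (Fin k → V)).val.map _).map _
  rw [Multiset.map_map, Multiset.map_map]
  refine Multiset.map_congr rfl fun f _ => ?_
  simp [walkColour, Fin.consEquiv, List.ofFn_succ]

/-- One round of a bijective game: walks are matched through their first intermediate vertex, and a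
different bijection may be used for the rest of the walk. -/
theorem kWalkRefinement_congr_equiv {k : ℕ} {χ : V → V → C} {χ' : V' → V' → C} {u v : V}
    {u' v' : V'} (β : V ≃ V') (h₁ : ∀ w, χ u w = χ' u' (β w))
    (h₂ : ∀ w, kWalkRefinement (k + 1) V C χ w v = kWalkRefinement (k + 1) V' C χ' (β w) v') :
    kWalkRefinement (k + 2) V C χ u v = kWalkRefinement (k + 2) V' C χ' u' v' := by
  have h : (Finset.univ : Finset V').val = (Finset.univ : Finset V).val.map β := by
    rw [← Finset.map_univ_equiv β, Finset.map_val]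
    rfl
  rw [kWalkRefinement_succ, kWalkRefinement_succ, h, Multiset.bind_map]
  exact Multiset.bind_congr fun w _ => by rw [h₁, h₂]

theorem exists_mem_kWalkRefinement (k : ℕ) (χ : V → V → C) (u v : V) :
    ∃ l, l ∈ kWalkRefinement (k + 1) V C χ u v := by
  refine ⟨_, Multiset.mem_map_of_mem _ (Finset.mem_univ fun _ => u)⟩

theorem length_of_mem_kWalkRefinement {k : ℕ} {χ : V → V → C} {u v : V} {l : List C}
    (h : l ∈ kWalkRefinement (k + 1) V C χ u v) : l.length = k + 1 := by
  induction k generalizing u l with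
  | zero =>
    rw [kWalkRefinement_one, Multiset.mem_singleton] at h
    simp [h]
  | succ k ih =>
    rw [kWalkRefinement_succ, Multiset.mem_bind] at h
    obtain ⟨w, -, h⟩ := h
    obtain ⟨l', h', rfl⟩ := Multiset.mem_map.1 h
    simp [ih h']

/-- Equal colours of `χ` and `χ'` agree on whether the pair is a loop. -/
def LoopCompatible (χ : V → V → C) (χ' : V' → V' → C) : Prop :=
  ∀ u v u' v', χ u v = χ' u' v' → (u = v ↔ u' = v')

open Classical in
theorem count_cons_kWalkRefinement (k : ℕ) (χ : V → V → C) (u v : V) (c : C) (l : List C) :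
    (kWalkRefinement (k + 2) V C χ u v).count (c :: l) =
      ∑ w, if χ u w = c then (kWalkRefinement (k + 1) V C χ w v).count l else 0 := by
  rw [kWalkRefinement_succ, Multiset.count_bind]
  change Finset.sum _ _ = _
  refine Finset.sum_congr rfl fun w _ => ?_
  split_ifs with h
  · rw [← h, Multiset.count_map_eq_count' _ _ (List.cons_injective)]
  · rw [Multiset.count_eq_zero]
    intro hm
    obtain ⟨l', -, h'⟩ := Multiset.mem_map.1 hm
    exact h (List.cons.inj h').1

/-- Loops are visible in the colours, so the walks of `k + 2` steps that start by staying at `u` can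
be singled out; removing the first step leaves all walks of `k + 1` steps. Thus longer walks refine
at least as much. -/
theorem kWalkRefinement_eq_of_succ {k : ℕ} {χ : V → V → C} {χ' : V' → V' → C}
    (h₁ : LoopCompatible χ χ) (h₂ : LoopCompatible χ χ') {u v : V} {u' v' : V'}
    (h : kWalkRefinement (k + 2) V C χ u v = kWalkRefinement (k + 2) V' C χ' u' v') :
    kWalkRefinement (k + 1) V C χ u v = kWalkRefinement (k + 1) V' C χ' u' v' := by
  classical
  -- A walk that starts by staying at `u` has a counterpart of the same colour, whose first step
  -- must be a loop at `u'`.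
  have hloop : χ' u' u' = χ u u := by
    obtain ⟨l, hl⟩ := exists_mem_kWalkRefinement k χ u v
    have hm : χ u u :: l ∈ kWalkRefinement (k + 2) V C χ u v := by
      rw [kWalkRefinement_succ, Multiset.mem_bind]
      exact ⟨u, Finset.mem_univ u, Multiset.mem_map_of_mem _ hl⟩
    rw [h, kWalkRefinement_succ, Multiset.mem_bind] at hm
    obtain ⟨w, -, hw⟩ := hm
    obtain ⟨l', -, h'⟩ := Multiset.mem_map.1 hw
    have hc := (List.cons.inj h').1
    have := (h₂ _ _ _ _ hc.symm).1 rfl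
    rw [← this] at hc
    exact hc
  ext l
  have hcount := congrArg (Multiset.count (χ u u :: l)) h
  rw [count_cons_kWalkRefinement, count_cons_kWalkRefinement, Finset.sum_eq_single u,
    Finset.sum_eq_single u', if_pos rfl, if_pos hloop] at hcount
  · exact hcount
  · exact fun w _ hw => if_neg fun hc => hw ((h₂ _ _ _ _ hc.symm).1 rfl).symm
  · simp
  · exact fun w _ hw => if_neg fun hc => hw ((h₁ _ _ _ _ hc.symm).1 rfl).symm
  · simp

theorem kWalkRefinement_eq_of_le {j k : ℕ} (hj : 1 ≤ j) (hjk : j ≤ k) {χ : V → V → C}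
    {χ' : V' → V' → C} (h₁ : LoopCompatible χ χ) (h₂ : LoopCompatible χ χ') {u v : V}
    {u' v' : V'} (h : kWalkRefinement k V C χ u v = kWalkRefinement k V' C χ' u' v') :
    kWalkRefinement j V C χ u v = kWalkRefinement j V' C χ' u' v' := by
  induction k, hjk using Nat.le_induction with
  | base => exact h
  | succ k hk ih =>
    obtain ⟨k, rfl⟩ : ∃ i, k = i + 1 := ⟨k - 1, by omega⟩
    exact ih (kWalkRefinement_eq_of_succ h₁ h₂ h)

/-- A sequence of finer and finer partitions of a finite set becomes stationary. -/
theorem exists_finer_of_chain {K : ℕ → Type} (χ : ∀ i, V → V → K i)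
    (h : ∀ i, Finer (χ (i + 1)) (χ i)) : ∃ i, ∀ j, Finer (χ i) (χ j) := by
  classical
  let S : ℕ → Finset ((V × V) × (V × V)) := fun i =>
    Finset.univ.filter fun q => χ i q.1.1 q.1.2 = χ i q.2.1 q.2.2
  have hS : Antitone S := antitone_nat_of_succ_le fun i q hq => by
    simp only [S, Finset.mem_filter, Finset.mem_univ, true_and] at hq ⊢
    exact h i _ _ _ _ hq
  obtain ⟨i, hi⟩ : ∃ i, ∀ j, (S i).card ≤ (S j).card :=
    ⟨Function.argmin fun i => (S i).card, fun j => Function.argmin_le (fun i => (S i).card) j⟩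
  -- The sets of equally coloured pairs decrease, and `i` minimizes their size, so nothing is lost
  -- after `i`.
  have key : ∀ j, S i ⊆ S j := fun j => by
    rcases le_total i j with hij | hij
    · exact (Finset.eq_of_subset_of_card_le (hS hij) (hi j)).ge
    · exact hS hij
  refine ⟨i, fun j u₁ v₁ u₂ v₂ hq => ?_⟩
  have : ((u₁, v₁), (u₂, v₂)) ∈ S j := key j (by simpa [S] using hq)
  simpa [S] using this

theorem walkLength_spec {χ : V → V → C} (h : LoopCompatible χ χ) :
    2 ≤ walkLength χ ∧ ∀ j : ℕ, 2 ≤ j →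
      Finer (kWalkRefinement (walkLength χ) V C χ) (kWalkRefinement j V C χ) := by
  refine Nat.sInf_mem (s := {k : ℕ | 2 ≤ k ∧ ∀ j : ℕ, 2 ≤ j →
    Finer (kWalkRefinement k V C χ) (kWalkRefinement j V C χ)}) ?_
  obtain ⟨i, hi⟩ := exists_finer_of_chain (fun i => kWalkRefinement (i + 2) V C χ)
    fun i u₁ v₁ u₂ v₂ hq => kWalkRefinement_eq_of_succ h h hq
  refine ⟨i + 2, by omega, fun j hj => ?_⟩
  obtain ⟨j, rfl⟩ : ∃ l, j = l + 2 := ⟨j - 2, by omega⟩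
  exact hi j

/-- The walk length depends only on which pairs get equal colours, so it is transported along any
surjection that preserves and reflects equality of walk colours. -/
theorem walkLength_congr {χ : V → V → C} {χ' : V' → V' → C'} (σ : V × V → V' × V')
    (hσ : Function.Surjective σ)
    (h : ∀ k, 2 ≤ k → ∀ z w, kWalkRefinement k V C χ z.1 z.2 = kWalkRefinement k V C χ w.1 w.2 ↔
      kWalkRefinement k V' C' χ' (σ z).1 (σ z).2 = kWalkRefinement k V' C' χ' (σ w).1 (σ w).2) :
    walkLength χ = walkLength χ' := by
  unfold walkLength
  congr 1
  ext k
  refine and_congr_right fun hk => forall₂_congr fun j hj => ?_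
  constructor
  · intro hf u₁ v₁ u₂ v₂ hq
    obtain ⟨z, hz⟩ := hσ (u₁, v₁)
    obtain ⟨w, hw⟩ := hσ (u₂, v₂)
    have h1 := (h k hk z w).2 (by rw [hz, hw]; exact hq)
    have h2 := (h j hj z w).1 (hf _ _ _ _ h1)
    rw [hz, hw] at h2
    exact h2
  · intro hf u₁ v₁ u₂ v₂ hq
    exact (h j hj (u₁, v₁) (u₂, v₂)).2 (hf _ _ _ _ ((h k hk (u₁, v₁) (u₂, v₂)).1 hq))

/-- The two colourings choose their walk lengths independently, but the length can be read off from
any tuple in the colour. -/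
theorem walkLength_eq_of_walkRefinement_eq {χ : V → V → C} {χ' : V' → V' → C}
    (h₁ : LoopCompatible χ χ) (h₂ : LoopCompatible χ' χ') {u v : V} {u' v' : V'}
    (h : walkRefinement V C χ u v = walkRefinement V' C χ' u' v') :
    walkLength χ = walkLength χ' := by
  have hk := (walkLength_spec h₁).1
  have hk' := (walkLength_spec h₂).1
  unfold walkRefinement at h
  obtain ⟨k, hkk⟩ : ∃ k, walkLength χ = k + 1 := ⟨walkLength χ - 1, by omega⟩
  obtain ⟨k', hkk'⟩ : ∃ k, walkLength χ' = k + 1 := ⟨walkLength χ' - 1, by omega⟩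
  rw [hkk, hkk'] at h ⊢
  obtain ⟨l, hl⟩ := exists_mem_kWalkRefinement k χ u v
  rw [← length_of_mem_kWalkRefinement hl, length_of_mem_kWalkRefinement (h ▸ hl)]

theorem kWalkRefinement_eq_of_walkRefinement_eq {χ : V → V → C} {χ' : V' → V' → C}
    (h₁ : LoopCompatible χ χ) (h₂ : LoopCompatible χ' χ') (h₃ : LoopCompatible χ χ')
    {u v : V} {u' v' : V'} (h : walkRefinement V C χ u v = walkRefinement V' C χ' u' v')
    {j : ℕ} (hj : 1 ≤ j) (hj2 : j ≤ 2) :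
    kWalkRefinement j V C χ u v = kWalkRefinement j V' C χ' u' v' := by
  have hk := walkLength_eq_of_walkRefinement_eq h₁ h₂ h
  unfold walkRefinement at h
  rw [← hk] at h
  exact kWalkRefinement_eq_of_le hj (hj2.trans (walkLength_spec h₁).1) h₁ h₃ h

end Abstract

/-! ### Iterated walk refinement of graphs -/

section Graphs

variable {V V' : Type}

theorem eq_iff_of_initialColouring_eq {H : SimpleGraph V} {H' : SimpleGraph V'} {u v : V}
    {u' v' : V'} (h : initialColouring H u v = initialColouring H' u' v') :
    u = v ↔ u' = v' := by
  unfold initialColouring at h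
  split_ifs at h <;> simp_all

theorem adj_iff_of_initialColouring_eq {H : SimpleGraph V} {H' : SimpleGraph V'} {u v : V}
    {u' v' : V'} (h : initialColouring H u v = initialColouring H' u' v') :
    H.Adj u v ↔ H'.Adj u' v' := by
  unfold initialColouring at h
  split_ifs at h <;> simp_all

theorem initialColouring_eq {H : SimpleGraph V} {H' : SimpleGraph V'} {u v : V}
    {u' v' : V'} (h₁ : u = v ↔ u' = v') (h₂ : H.Adj u v ↔ H'.Adj u' v') :
    initialColouring H u v = initialColouring H' u' v' := by
  unfold initialColouring
  classical
  exact if_congr h₁ rfl (if_congr h₂ rfl rfl)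

variable [Fintype V] [Fintype V']

/-- The colouring after `m` iterations of walk refinement. -/
noncomputable abbrev walkIterate (H : SimpleGraph V) (m : ℕ) : V → V → IterColour ℤ m :=
  iterate walkRefinement (initialColouring H) m

theorem initialColouring_eq_of_walkIterate_eq (m : ℕ) :
    ∀ {V V' : Type} [Fintype V] [Fintype V'] (H : SimpleGraph V) (H' : SimpleGraph V')
      {u v : V} {u' v' : V'}, walkIterate H m u v = walkIterate H' m u' v' →
      initialColouring H u v = initialColouring H' u' v' := by
  induction m with
  | zero => exact fun _ _ _ _ _ _ h => h
  | succ m ih =>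
    intro V V' _ _ H H' u v u' v' h
    refine ih H H' ?_
    have lc : ∀ {V V' : Type} [Fintype V] [Fintype V'] (H : SimpleGraph V)
        (H' : SimpleGraph V'), LoopCompatible (walkIterate H m) (walkIterate H' m) :=
      fun H H' _ _ _ _ h => eq_iff_of_initialColouring_eq (ih H H' h)
    have := kWalkRefinement_eq_of_walkRefinement_eq (lc H H) (lc H' H') (lc H H') h
      le_rfl one_le_two
    simpa [kWalkRefinement_one] using this

theorem loopCompatible_walkIterate (H : SimpleGraph V) (H' : SimpleGraph V') (m : ℕ) :
    LoopCompatible (walkIterate H m) (walkIterate H' m) :=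
  fun _ _ _ _ h => eq_iff_of_initialColouring_eq (initialColouring_eq_of_walkIterate_eq m H H' h)

theorem kWalkRefinement_eq_of_walkIterate_succ_eq {H : SimpleGraph V} {H' : SimpleGraph V'}
    {m : ℕ} {u v : V} {u' v' : V'} (h : walkIterate H (m + 1) u v = walkIterate H' (m + 1) u' v')
    {j : ℕ} (hj : 1 ≤ j) (hj2 : j ≤ 2) :
    kWalkRefinement j V _ (walkIterate H m) u v =
      kWalkRefinement j V' _ (walkIterate H' m) u' v' :=
  kWalkRefinement_eq_of_walkRefinement_eq (loopCompatible_walkIterate H H m)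
    (loopCompatible_walkIterate H' H' m) (loopCompatible_walkIterate H H' m) h hj hj2

theorem walkIterate_eq_of_succ {H : SimpleGraph V} {H' : SimpleGraph V'}
    {m : ℕ} {u v : V} {u' v' : V'}
    (h : walkIterate H (m + 1) u v = walkIterate H' (m + 1) u' v') :
    walkIterate H m u v = walkIterate H' m u' v' := by
  have := kWalkRefinement_eq_of_walkIterate_succ_eq h le_rfl one_le_two
  simpa [kWalkRefinement_one] using this

theorem exists_samePartition_walkIterate (H : SimpleGraph V) :
    ∃ m, SamePartition (walkIterate H m) (walkIterate H (m + 1)) := by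
  obtain ⟨m, hm⟩ := exists_finer_of_chain (fun m => walkIterate H m)
    fun m _ _ _ _ h => walkIterate_eq_of_succ h
  exact ⟨m, hm (m + 1), fun _ _ _ _ h => walkIterate_eq_of_succ h⟩

theorem samePartition_iterationNumber (H : SimpleGraph V) :
    SamePartition (walkIterate H (iterationNumber walkRefinement H))
      (walkIterate H (iterationNumber walkRefinement H + 1)) :=
  Nat.sInf_mem (s := {m : ℕ | SamePartition (walkIterate H m) (walkIterate H (m + 1))})
    (exists_samePartition_walkIterate H)

/-- Colourings of two graphs with common colours that walk refinement does not refine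
any further and does not use to distinguish the graphs. -/
structure StablePair {C : Type} (H : SimpleGraph V) (H' : SimpleGraph V') (χ : V → V → C)
    (χ' : V' → V' → C) : Prop where
  init : ∀ {u v u' v'}, χ u v = χ' u' v' → initialColouring H u v = initialColouring H' u' v'
  left : ∀ u v, ∃ u' v', χ u v = χ' u' v'
  right : ∀ u' v', ∃ u v, χ u v = χ' u' v'
  walk : ∀ {u v u' v'}, χ u v = χ' u' v' →
    kWalkRefinement 2 V C χ u v = kWalkRefinement 2 V' C χ' u' v'

theorem StablePair.symm {C : Type} {H : SimpleGraph V} {H' : SimpleGraph V'} {χ : V → V → C}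
    {χ' : V' → V' → C} (h : StablePair H H' χ χ') : StablePair H' H χ' χ where
  init e := (h.init e.symm).symm
  left u v := (h.right u v).imp fun _ ⟨w, hw⟩ => ⟨w, hw.symm⟩
  right u v := (h.left u v).imp fun _ ⟨w, hw⟩ => ⟨w, hw.symm⟩
  walk e := (h.walk e.symm).symm

theorem exists_eq_of_pairColours_eq {C : Type} {χ : V → V → C} {χ' : V' → V' → C}
    (h : pairColours χ = pairColours χ') (u v : V) : ∃ u' v', χ u v = χ' u' v' := by
  have hm : χ u v ∈ pairColours χ :=
    Multiset.mem_map_of_mem (fun q : V × V => χ q.1 q.2) (Finset.mem_univ (u, v))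
  rw [h] at hm
  obtain ⟨q, -, hq⟩ := Multiset.mem_map.1 hm
  exact ⟨q.1, q.2, hq.symm⟩

/-- Stability is needed in `H` only: a pair of `H'` has a partner in `H` with the same colour after
`m + 1` iterations, and by stability every pair of `H` with the right colour after `m` iterations
agrees with that partner after `m + 1`. -/
theorem stablePair_of_samePartition {H : SimpleGraph V} {H' : SimpleGraph V'} {m : ℕ}
    (hs : SamePartition (walkIterate H m) (walkIterate H (m + 1)))
    (hd : ¬ DistinguishesIn walkRefinement (m + 1) H H') :
    StablePair H H' (walkIterate H m) (walkIterate H' m) := by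
  have hd : pairColours (walkIterate H (m + 1)) = pairColours (walkIterate H' (m + 1)) :=
    not_not.1 hd
  refine ⟨initialColouring_eq_of_walkIterate_eq m H H', fun u v => ?_, fun u v => ?_, ?_⟩
  · obtain ⟨u', v', h⟩ := exists_eq_of_pairColours_eq hd u v
    exact ⟨u', v', walkIterate_eq_of_succ h⟩
  · obtain ⟨u', v', h⟩ := exists_eq_of_pairColours_eq hd.symm u v
    exact ⟨u', v', (walkIterate_eq_of_succ h).symm⟩
  · intro u v u' v' h
    obtain ⟨x, y, hxy⟩ := exists_eq_of_pairColours_eq hd.symm u' v'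
    have h1 := hs.1 _ _ _ _ (h.trans (walkIterate_eq_of_succ hxy))
    exact kWalkRefinement_eq_of_walkIterate_succ_eq (h1.trans hxy.symm) one_le_two le_rfl

theorem DistinguishesIn.symm {r : ColouringOperator} {m : ℕ} {H : SimpleGraph V}
    {H' : SimpleGraph V'} (h : DistinguishesIn r m H H') : DistinguishesIn r m H' H :=
  Ne.symm h

end Graphs

set_option linter.unusedSectionVars false

section Twist

variable {B : Type} [Fintype B] [DecidableEq B] {G : SimpleGraph B} [DecidableRel G.Adj]

/-! ### Coordinates of gadget vertices -/

/-- The component of a gadget vertex belonging to the base edge to `r`, or `0`. -/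
def comp (x : CFIVertex G) (r : B) : ZMod 2 :=
  if h : G.Adj x.1 r then (if x.2.1 ⟨r, h⟩ = true then 1 else 0) else 0

theorem comp_of_not_adj {x : CFIVertex G} {r : B} (h : ¬ G.Adj x.1 r) : comp x r = 0 :=
  dif_neg h

theorem sum_neighborSet (p : B) (g : B → ZMod 2) (hg : ∀ r, ¬ G.Adj p r → g r = 0) :
    ∑ r, g r = ∑ w : G.neighborSet p, g w := by
  rw [← Finset.sum_filter_of_ne (p := G.Adj p) fun r _ h => by_contra fun h' => h (hg r h')]
  exact Finset.sum_subtype _ (by simp) g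

theorem sum_comp (x : CFIVertex G) : ∑ r, comp x r = 0 := by
  rw [sum_neighborSet x.1 (comp x) fun r h => comp_of_not_adj h]
  have h : ∀ w : G.neighborSet x.1, comp x w = if x.2.1 w = true then 1 else 0 :=
    fun w => dif_pos w.2
  simp only [h]
  rw [Finset.sum_boole, ZMod.natCast_eq_zero_iff_even]
  exact x.2.2

theorem vertex_ext {x y : CFIVertex G} (h : x.1 = y.1) (hc : ∀ r, comp x r = comp y r) :
    x = y := by
  obtain ⟨p, a, ha⟩ := x
  obtain ⟨q, b, hb⟩ := y
  obtain rfl : p = q := h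
  have : a = b := by
    ext w
    have := hc w
    have hw : G.Adj p w := w.2
    simp only [comp, hw, dif_pos] at this
    cases h1 : a w <;> cases h2 : b w <;> simp_all
  subst this
  rfl

theorem ite_decide_eq_one (a : ZMod 2) : (if decide (a = 1) = true then 1 else 0 : ZMod 2) = a := by
  revert a
  decide

/-- The gadget vertex with prescribed components. -/
def mkVertex (p : B) (g : B → ZMod 2) (hg : ∀ r, ¬ G.Adj p r → g r = 0)
    (hs : ∑ r, g r = 0) : CFIVertex G :=
  ⟨p, fun w => decide (g w = 1), by
    rw [sum_neighborSet p g hg] at hs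
    rw [← ZMod.natCast_eq_zero_iff_even, ← Finset.sum_boole]
    exact (Finset.sum_congr rfl fun w _ => ite_decide_eq_one _).trans hs⟩

@[simp]
theorem comp_mkVertex (p : B) (g : B → ZMod 2) (hg : ∀ r, ¬ G.Adj p r → g r = 0)
    (hs : ∑ r, g r = 0) (r : B) : comp (mkVertex p g hg hs) r = g r := by
  by_cases h : G.Adj p r
  · exact (dif_pos h).trans (ite_decide_eq_one _)
  · exact (comp_of_not_adj h).trans (hg r h).symm

/-- The graph `X(G)`, where the edges and non-edges over the base edges with `t = 1` are
interchanged. -/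
def twistGraph (G : SimpleGraph B) [DecidableRel G.Adj] (t : Sym2 B → ZMod 2) :
    SimpleGraph (CFIVertex G) where
  Adj x y := G.Adj x.1 y.1 ∧ comp x y.1 + comp y x.1 = t s(x.1, y.1)
  symm := ⟨fun x y h => ⟨h.1.symm, by rw [add_comm, h.2, Sym2.eq_swap]⟩⟩
  loopless := ⟨fun _ h => G.loopless.irrefl _ h.1⟩

/-- The indicator function of a base edge. -/
def edgeIndicator (e : Sym2 B) (s : Sym2 B) : ZMod 2 := if s = e then 1 else 0

theorem comp_add_comp_eq_zero_iff {x y : CFIVertex G} (h : G.Adj x.1 y.1) :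
    comp x y.1 + comp y x.1 = 0 ↔ x.2.1 ⟨y.1, h⟩ = y.2.1 ⟨x.1, h.symm⟩ := by
  unfold comp
  rw [dif_pos h, dif_pos h.symm]
  generalize x.2.1 ⟨y.1, h⟩ = a
  generalize y.2.1 ⟨x.1, h.symm⟩ = b
  revert a b
  decide

theorem cfi_eq_twistGraph : cfi G = twistGraph G 0 := by
  ext x y
  constructor
  · rintro ⟨h, e⟩
    exact ⟨h, (comp_add_comp_eq_zero_iff h).2 e⟩
  · rintro ⟨h, e⟩
    exact ⟨h, (comp_add_comp_eq_zero_iff h).1 e⟩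

theorem cfiTwisted_eq_twistGraph (e : G.edgeSet) :
    cfiTwisted G e = twistGraph G (edgeIndicator e.1) := by
  have key : ∀ a : ZMod 2, a ≠ 0 ↔ a = 1 := by decide
  ext x y
  change ((cfi G).Adj x y ∧ s(x.1, y.1) ≠ e.1) ∨ (¬ (cfi G).Adj x y ∧ s(x.1, y.1) = e.1) ↔
    G.Adj x.1 y.1 ∧ _
  rw [cfi_eq_twistGraph]
  change (((G.Adj x.1 y.1 ∧ comp x y.1 + comp y x.1 = 0) ∧ _) ∨
    (¬ (G.Adj x.1 y.1 ∧ comp x y.1 + comp y x.1 = 0) ∧ _)) ↔ _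
  unfold edgeIndicator
  by_cases h : s(x.1, y.1) = e.1
  · have hadj : G.Adj x.1 y.1 := by
      rw [← SimpleGraph.mem_edgeSet, h]
      exact e.2
    rw [if_pos h, ← key]
    simp [h, hadj]
  · rw [if_neg h]
    simp [h]

/-! ### Switching gadget components -/

/-- For every base vertex, an even set of components to be switched. -/
structure Switching (G : SimpleGraph B) where
  row : B → B → ZMod 2
  supp : ∀ p r, ¬ G.Adj p r → row p r = 0
  even : ∀ p, ∑ r, row p r = 0

namespace Switching

/-- The gadget vertex obtained by switching components. -/
def act (f : Switching G) (x : CFIVertex G) : CFIVertex G :=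
  mkVertex x.1 (fun r => comp x r + f.row x.1 r)
    (fun r h => by rw [comp_of_not_adj h, f.supp _ _ h, add_zero])
    (by rw [Finset.sum_add_distrib, sum_comp, f.even, add_zero])

@[simp]
theorem act_fst (f : Switching G) (x : CFIVertex G) : (f.act x).1 = x.1 := rfl

@[simp]
theorem comp_act (f : Switching G) (x : CFIVertex G) (r : B) :
    comp (f.act x) r = comp x r + f.row x.1 r :=
  comp_mkVertex ..

theorem act_congr {f f' : Switching G} {x : CFIVertex G} (h : f.row x.1 = f'.row x.1) :
    f.act x = f'.act x :=
  vertex_ext rfl fun r => by simp [h]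

theorem act_act (f : Switching G) (x : CFIVertex G) : f.act (f.act x) = x :=
  vertex_ext rfl fun r => by
    rw [comp_act, comp_act, act_fst, add_assoc, CharTwo.add_self_eq_zero, add_zero]

/-- Switching gadget components as a permutation of the vertices. -/
def equiv (f : Switching G) : CFIVertex G ≃ CFIVertex G :=
  ⟨f.act, f.act, f.act_act, f.act_act⟩

/-- The switching `f` accounts for the twists `t`, except that it is wrong at the edge `e`. -/
def SolvesExcept (f : Switching G) (t : Sym2 B → ZMod 2) (e : Sym2 B) : Prop :=
  ∀ p r, G.Adj p r → f.row p r + f.row r p = t s(p, r) + edgeIndicator e s(p, r)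

/-- Away from the wrong edge, the flips cancel the difference of the two twists, so adjacency is
preserved. -/
theorem initialColouring_act {f : Switching G} {t t' : Sym2 B → ZMod 2} {e : Sym2 B}
    (hf : f.SolvesExcept (t + t') e) {x y : CFIVertex G} (he : e ≠ s(x.1, y.1)) :
    initialColouring (twistGraph G t) x y =
      initialColouring (twistGraph G t') (f.act x) (f.act y) := by
  refine initialColouring_eq f.equiv.injective.eq_iff.symm ?_
  change _ ∧ _ ↔ G.Adj x.1 y.1 ∧ comp (f.act x) y.1 + comp (f.act y) x.1 = t' s(x.1, y.1)
  refine and_congr_right fun h => ?_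
  have h1 := hf _ _ h
  rw [edgeIndicator, if_neg he.symm, Pi.add_apply] at h1
  rw [comp_act, comp_act]
  generalize t s(x.1, y.1) = a at *
  generalize t' s(x.1, y.1) = b at *
  generalize f.row x.1 y.1 = c at *
  generalize f.row y.1 x.1 = d at *
  generalize comp x y.1 = i at *
  generalize comp y x.1 = j at *
  revert a b c d i j
  decide

end Switching

/-- Every switching that is wrong at `e` can be changed, outside of `P`, into one that is wrong
at `e'` instead. -/
def Moves (G : SimpleGraph B) (P : Set B) (e e' : Sym2 B) : Prop :=
  ∀ (t : Sym2 B → ZMod 2) (f : Switching G), f.SolvesExcept t e →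
    ∃ f' : Switching G, f'.SolvesExcept t e' ∧ ∀ p ∈ P, f'.row p = f.row p

theorem Moves.refl (P : Set B) (e : Sym2 B) : Moves G P e e := fun _ f hf => ⟨f, hf, fun _ _ => rfl⟩

theorem Moves.trans {P : Set B} {e₁ e₂ e₃ : Sym2 B} (h : Moves G P e₁ e₂)
    (h' : Moves G P e₂ e₃) : Moves G P e₁ e₃ := fun t f hf => by
  obtain ⟨f₁, hf₁, h₁⟩ := h t f hf
  obtain ⟨f₂, hf₂, h₂⟩ := h' t f₁ hf₁
  exact ⟨f₂, hf₂, fun p hp => (h₂ p hp).trans (h₁ p hp)⟩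

/-- Flipping the components `r` and `r'` at `y` keeps the parity there and changes the balance on
the edges to `r` and `r'` only. All longer moves are composed of this one. -/
theorem moves_of_adj {P : Set B} {y r r' : B} (hy : y ∉ P) (hr : G.Adj y r) (hr' : G.Adj y r') :
    Moves G P s(y, r) s(y, r') := by
  intro t f hf
  refine ⟨⟨fun p c => f.row p c + if p = y then Pi.single r 1 c + Pi.single r' 1 c else 0,
    fun p c h => ?_, fun p => ?_⟩, fun p c h => ?_, fun p hp => ?_⟩
  · rw [f.supp p c h, zero_add]
    split_ifs with hp
    · subst hp
      rw [Pi.single_eq_of_ne, Pi.single_eq_of_ne, add_zero] <;> rintro rfl <;> contradiction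
    · rfl
  · rw [Finset.sum_add_distrib, f.even, zero_add]
    split_ifs with hp
    · rw [Finset.sum_add_distrib, Finset.sum_pi_single', Finset.sum_pi_single']
      simp [CharTwo.add_self_eq_zero]
    · simp
  · have h0 := hf p c h
    have h1 : edgeIndicator s(y, r) s(p, c) + edgeIndicator s(y, r') s(p, c) =
        (if p = y then Pi.single (M := fun _ => ZMod 2) r 1 c + Pi.single (M := fun _ => ZMod 2) r' 1 c else 0) +
        (if c = y then Pi.single (M := fun _ => ZMod 2) r 1 p + Pi.single (M := fun _ => ZMod 2) r' 1 p else 0) := by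
      have hpc := h.ne
      have hyr := hr.ne
      have hyr' := hr'.ne
      simp only [edgeIndicator, Sym2.eq_iff, Pi.single_apply]
      by_cases hp : p = y
      · subst hp
        simp [hpc.symm, hyr, hyr']
      · by_cases hc : c = y
        · subst hc
          simp [hp]
        · simp [hp, hc]
    linear_combination h0 - h1 + CharTwo.add_self_eq_zero (edgeIndicator s(y, r) s(p, c))
  · have : p ≠ y := fun h => hy (h ▸ hp)
    funext c
    simp [this]

/-! ### Invariance of the colours under switching -/

/-- A set of edges in which the wrong edge of a switching can be hidden from a walk that ends
at `q`. -/
structure Evades (G : SimpleGraph B) (S : Set (Sym2 B)) (q : B) : Prop where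
  ne : ∀ e ∈ S, ∀ b, e ≠ s(b, q)
  move : ∀ b c, ∀ e ∈ S, ∃ e' ∈ S, e' ≠ s(b, c) ∧ Moves G {b, q} e e'

/-- While the walk proceeds, the error is moved within `S`, freezing only the gadgets of the current
vertex and of the endpoint. The error never blocks the last step, since no edge in `S` touches `q`;
hence the length of the walk is irrelevant. -/
theorem kWalkRefinement_act {C : Type} {χ χ' : CFIVertex G → CFIVertex G → C}
    {t : Sym2 B → ZMod 2} {S : Set (Sym2 B)}
    (hχ : ∀ (f : Switching G), ∀ e ∈ S, f.SolvesExcept t e →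
      ∀ x y : CFIVertex G, e ≠ s(x.1, y.1) → χ x y = χ' (f.act x) (f.act y))
    {q : B} (hS : Evades G S q) (k : ℕ) :
    ∀ (f : Switching G), ∀ e ∈ S, f.SolvesExcept t e → ∀ x y : CFIVertex G, y.1 = q →
      kWalkRefinement (k + 1) _ _ χ x y = kWalkRefinement (k + 1) _ _ χ' (f.act x) (f.act y) := by
  induction k with
  | zero =>
    rintro f e he hf x y rfl
    rw [kWalkRefinement_one, kWalkRefinement_one, hχ f e he hf x y (hS.ne e he _)]
  | succ k ih =>
    rintro f e he hf x y rfl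
    choose g hg hne hm using fun c => hS.move x.1 c e he
    choose F hF hrow using fun c => hm c t f hf
    -- The switching `F c` answers a next vertex over `c`. Being a `Switching` is a condition on
    -- each row separately, so gluing these answers gives a permutation, even though it need not
    -- account for the twists.
    let F' : Switching G := ⟨fun c => (F c).row c, fun c => (F c).supp c, fun c => (F c).even c⟩
    have hw : ∀ w, F'.act w = (F w.1).act w := fun w => Switching.act_congr rfl
    have hx : ∀ c, f.act x = (F c).act x := fun c =>
      Switching.act_congr (hrow c _ (by simp)).symm
    have hy : ∀ c, f.act y = (F c).act y := fun c =>
      Switching.act_congr (hrow c _ (by simp)).symm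
    refine kWalkRefinement_congr_equiv F'.equiv (fun w => ?_) (fun w => ?_)
    · change _ = χ' _ (F'.act w)
      rw [hw, hx w.1]
      exact hχ _ _ (hg _) (hF _) _ _ (hne _)
    · change _ = kWalkRefinement _ _ _ _ (F'.act w) _
      rw [hw, hy w.1]
      exact ih _ _ (hg _) (hF _) _ _ rfl

/-- The colours given by `r` to a pair only depend on the walk refinements, on corresponding
colourings. -/
def IsWalkOperator (r : ColouringOperator) : Prop :=
  ∀ {V V' : Type} [Fintype V] [Fintype V'] {C : Type} (χ : V → V → C) (χ' : V' → V' → C)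
    (σ : V × V → V' × V'), Function.Surjective σ →
    (∀ k, ∀ z, kWalkRefinement (k + 1) V C χ z.1 z.2 =
      kWalkRefinement (k + 1) V' C χ' (σ z).1 (σ z).2) →
    ∀ u v u' v', (∀ k, kWalkRefinement (k + 1) V C χ u v =
      kWalkRefinement (k + 1) V' C χ' u' v') → r V C χ u v = r V' C χ' u' v'

theorem kWalkRefinement_isWalkOperator (k : ℕ) : IsWalkOperator (kWalkRefinement k) := by
  intro V V' _ _ C χ χ' σ _ _ u v u' v' h
  rcases k with _ | k
  · exact h 0
  · exact h k

/-- Walk refinement is not local, as its length depends on the whole colouring; this is why the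
correspondence `σ` of all pairs is part of `IsWalkOperator`. -/
theorem walkRefinement_isWalkOperator : IsWalkOperator walkRefinement := by
  intro V V' _ _ C χ χ' σ hσ hk u v u' v' h
  have : walkLength χ = walkLength χ' := walkLength_congr σ hσ fun k hk2 z w => by
    obtain ⟨k, rfl⟩ : ∃ i, k = i + 1 := ⟨k - 1, by omega⟩
    rw [hk, hk]
  unfold walkRefinement
  rw [this]
  exact kWalkRefinement_isWalkOperator _ χ χ' σ hσ hk u v u' v' h

/-- The correspondence of vertex pairs given by a switching for every pair of base vertices. -/
def actPair (F : B → B → Switching G) (z : CFIVertex G × CFIVertex G) :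
    CFIVertex G × CFIVertex G :=
  ((F z.1.1 z.2.1).act z.1, (F z.1.1 z.2.1).act z.2)

theorem actPair_involutive (F : B → B → Switching G) : Function.Involutive (actPair F) :=
  fun _ => Prod.ext (Switching.act_act _ _) (Switching.act_act _ _)

/-- Sets of edges which hide the wrong edge of a switching during `m` iterations. -/
structure HidingFamily (G : SimpleGraph B) (t : Sym2 B → ZMod 2)
    (good : ℕ → Set (Sym2 B) → Prop) : Prop where
  start : ∀ m S, good m S → ∀ p q, ∃ e ∈ S, e ≠ s(p, q) ∧
    ∃ f : Switching G, f.SolvesExcept t e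
  step : ∀ m S, good (m + 1) S → ∀ p q, ∀ e ∈ S, e ≠ s(p, q) →
    ∃ S', good m S' ∧ Evades G S' q ∧ ∃ e' ∈ S', Moves G {p, q} e e'

/-- Before the walks of an iteration are compared, the error is moved, with the gadgets of `x` and
`y` frozen, to a set that evades the base vertex of `y`. -/
theorem iterate_act {t t' : Sym2 B → ZMod 2} {good : ℕ → Set (Sym2 B) → Prop}
    (hgood : HidingFamily G (t + t') good) {r : ColouringOperator} (hr : IsWalkOperator r)
    (m : ℕ) : ∀ S, good m S → ∀ (f : Switching G), ∀ e ∈ S, f.SolvesExcept (t + t') e →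
      ∀ x y : CFIVertex G, e ≠ s(x.1, y.1) →
      iterate r (initialColouring (twistGraph G t)) m x y =
        iterate r (initialColouring (twistGraph G t')) m (f.act x) (f.act y) := by
  induction m with
  | zero => exact fun S _ f e _ hf x y he => Switching.initialColouring_act hf he
  | succ m ih =>
    intro S hS
    have hwalk : ∀ (f : Switching G), ∀ e ∈ S, f.SolvesExcept (t + t') e →
        ∀ x y : CFIVertex G, e ≠ s(x.1, y.1) → ∀ k,
        kWalkRefinement (k + 1) _ _ (iterate r (initialColouring (twistGraph G t)) m) x y =
        kWalkRefinement (k + 1) _ _ (iterate r (initialColouring (twistGraph G t')) m)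
          (f.act x) (f.act y) := by
      intro f e he hf x y hxy k
      obtain ⟨S', hS', hev, e', he', hm⟩ := hgood.step m S hS x.1 y.1 e he hxy
      obtain ⟨f', hf', hrow⟩ := hm _ f hf
      rw [← Switching.act_congr (hrow x.1 (by simp)), ← Switching.act_congr (hrow y.1 (by simp))]
      exact kWalkRefinement_act (ih S' hS') hev k f' e' he' hf' x y rfl
    -- Each pair of base vertices gets a switching whose error avoids it; together they match all
    -- vertex pairs, so that the walk lengths of the two colourings agree.
    choose e he hne F hF using hgood.start (m + 1) S hS
    intro f e' he' hf x y hxy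
    exact hr _ _ (actPair F) (actPair_involutive F).surjective
      (fun k z => hwalk _ _ (he _ _) (hF _ _) _ _ (hne _ _) k) _ _ _ _
      (hwalk f e' he' hf x y hxy)

theorem not_distinguishesIn {t t' : Sym2 B → ZMod 2} {good : ℕ → Set (Sym2 B) → Prop}
    (hgood : HidingFamily G (t + t') good) {r : ColouringOperator} (hr : IsWalkOperator r)
    {m : ℕ} {S : Set (Sym2 B)} (hS : good m S) :
    ¬ DistinguishesIn r m (twistGraph G t) (twistGraph G t') := by
  choose e he hne F hF using hgood.start m S hS
  refine not_not.2 ?_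
  let σ : CFIVertex G × CFIVertex G ≃ CFIVertex G × CFIVertex G :=
    (actPair_involutive F).toPerm
  have h : (Finset.univ : Finset (CFIVertex G × CFIVertex G)).val =
      (Finset.univ : Finset (CFIVertex G × CFIVertex G)).val.map σ := by
    conv_lhs => rw [← Finset.map_univ_equiv σ, Finset.map_val]
    rfl
  unfold pairColours
  conv_rhs => rw [h, Multiset.map_map]
  exact Multiset.map_congr rfl fun z _ =>
    iterate_act hgood hr m S hS _ _ (he _ _) (hF _ _) _ _ (hne _ _)

end Twist

/-! ### Hiding the error on four-cycles and in ladders -/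

section FourCycle

variable {B : Type} [Fintype B] [DecidableEq B] {G : SimpleGraph B} [DecidableRel G.Adj]

/-- The edges of a four-cycle. -/
def fourCycle (v₀ v₁ v₂ v₃ : B) : Set (Sym2 B) := {s(v₀, v₁), s(v₁, v₂), s(v₂, v₃), s(v₃, v₀)}

/-- If the error sits on `s(b, c)`, then `c` is a vertex of the cycle, so it differs from `q` and is
not frozen; a flip at `c` moves the error to the other cycle edge at `c`. -/
theorem evades_fourCycle {v₀ v₁ v₂ v₃ q : B} (h₀₁ : G.Adj v₀ v₁) (h₁₂ : G.Adj v₁ v₂)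
    (h₂₃ : G.Adj v₂ v₃) (h₃₀ : G.Adj v₃ v₀) (h₀₂ : v₀ ≠ v₂) (h₁₃ : v₁ ≠ v₃)
    (hq₀ : v₀ ≠ q) (hq₁ : v₁ ≠ q) (hq₂ : v₂ ≠ q) (hq₃ : v₃ ≠ q) :
    Evades G (fourCycle v₀ v₁ v₂ v₃) q := by
  have corner : ∀ {v w w' : B}, G.Adj v w → G.Adj v w' → w ≠ w' → v ≠ q →
      s(v, w') ∈ fourCycle v₀ v₁ v₂ v₃ → ∃ e' ∈ fourCycle v₀ v₁ v₂ v₃,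
        e' ≠ s(w, v) ∧ Moves G {w, q} s(w, v) e' := by
    intro v w w' hw hw' hne hv hmem
    refine ⟨_, hmem, ?_, ?_⟩
    · rw [Sym2.eq_swap]
      simp only [ne_eq, Sym2.eq_iff]
      rintro (⟨rfl, -⟩ | ⟨rfl, -⟩)
      · exact hne rfl
      · exact hw'.ne rfl
    · rw [Sym2.eq_swap]
      exact moves_of_adj (by simp [hw.ne, hv]) hw hw'
  have m₀ : s(v₀, v₁) ∈ fourCycle v₀ v₁ v₂ v₃ := by simp [fourCycle]
  have m₁ : s(v₁, v₂) ∈ fourCycle v₀ v₁ v₂ v₃ := by simp [fourCycle]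
  have m₂ : s(v₂, v₃) ∈ fourCycle v₀ v₁ v₂ v₃ := by simp [fourCycle]
  have m₃ : s(v₃, v₀) ∈ fourCycle v₀ v₁ v₂ v₃ := by simp [fourCycle]
  constructor
  · intro e he b hb
    simp only [fourCycle, Set.mem_insert_iff, Set.mem_singleton_iff] at he
    rcases he with rfl | rfl | rfl | rfl <;> rw [Sym2.eq_iff] at hb <;>
      rcases hb with ⟨-, h⟩ | ⟨h, -⟩ <;> contradiction
  · intro b c e he
    by_cases hbc : e = s(b, c)
    · subst hbc
      simp only [fourCycle, Set.mem_insert_iff, Set.mem_singleton_iff, Sym2.eq_iff] at he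
      rcases he with (⟨rfl, rfl⟩ | ⟨rfl, rfl⟩) | (⟨rfl, rfl⟩ | ⟨rfl, rfl⟩) |
        (⟨rfl, rfl⟩ | ⟨rfl, rfl⟩) | (⟨rfl, rfl⟩ | ⟨rfl, rfl⟩)
      · exact corner h₀₁.symm h₁₂ h₀₂ hq₁ m₁
      · exact corner h₀₁ h₃₀.symm h₁₃ hq₀ (Sym2.eq_swap ▸ m₃)
      · exact corner h₁₂.symm h₂₃ h₁₃ hq₂ m₂
      · exact corner h₁₂ h₀₁.symm h₀₂.symm hq₁ (Sym2.eq_swap ▸ m₀)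
      · exact corner h₂₃.symm h₃₀ h₀₂.symm hq₃ m₃
      · exact corner h₂₃ h₁₂.symm h₁₃.symm hq₂ (Sym2.eq_swap ▸ m₁)
      · exact corner h₃₀.symm h₀₁ h₁₃.symm hq₀ m₀
      · exact corner h₃₀ h₂₃.symm h₀₂ hq₃ (Sym2.eq_swap ▸ m₂)
    · exact ⟨e, he, hbc, Moves.refl _ _⟩

/-- In a ladder with rungs `a₁b₁`, `a₂b₂`, `a₃b₃`, an edge of the second cell can be moved to
one of the outer rungs while `a₂` and a further vertex `p` are blocked. -/
theorem moves_to_rung {a₁ b₁ a₂ b₂ a₃ b₃ p : B} {e : Sym2 B} (h₁ : G.Adj a₁ b₁)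
    (h₂ : G.Adj a₂ b₂) (h₃ : G.Adj a₃ b₃) (ha : G.Adj a₂ a₃) (hb : G.Adj b₁ b₂)
    (hb' : G.Adj b₂ b₃) (n₁ : b₁ ≠ a₂) (n₂ : b₁ ≠ b₃) (n₃ : b₃ ≠ a₂)
    (he : e = s(a₂, b₂) ∨ e = s(a₃, b₃) ∨ e = s(a₂, a₃) ∨ e = s(b₂, b₃))
    (hp : e ≠ s(p, a₂)) : Moves G {p, a₂} e s(a₁, b₁) ∨ Moves G {p, a₂} e s(a₃, b₃) := by
  -- The escape through `b₃` is blocked only if `p = b₃`; then `b₂` and `b₁` are free and the error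
  -- leaves on the other side.
  have left : p = b₃ → ∀ {r}, G.Adj b₂ r → Moves G {p, a₂} s(b₂, r) s(a₁, b₁) := by
    rintro rfl r hr
    refine (moves_of_adj (r' := b₁) ?_ hr hb.symm).trans ?_
    · simp [h₂.ne', hb'.ne]
    · rw [Sym2.eq_swap (a := a₁), Sym2.eq_swap (a := b₂)]
      exact moves_of_adj (by simp [n₁, n₂]) hb h₁.symm
  have right : p ≠ b₃ → Moves G {p, a₂} s(b₂, b₃) s(a₃, b₃) := by
    intro hpb
    rw [Sym2.eq_swap (a := a₃), Sym2.eq_swap (a := b₂)]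
    exact moves_of_adj (by simp [hpb.symm, n₃]) hb'.symm h₃.symm
  rcases he with rfl | rfl | rfl | rfl
  · have hpb : b₂ ≠ p := by
      rintro rfl
      exact hp Sym2.eq_swap
    rw [Sym2.eq_swap (a := a₂)]
    by_cases hpb' : p = b₃
    · exact Or.inl (left hpb' h₂.symm)
    · exact Or.inr ((moves_of_adj (by simp [hpb, h₂.ne']) h₂.symm hb').trans (right hpb'))
  · exact Or.inr (Moves.refl _ _)
  · have hpa : a₃ ≠ p := by
      rintro rfl
      exact hp Sym2.eq_swap
    rw [Sym2.eq_swap (a := a₂)]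
    exact Or.inr (moves_of_adj (by simp [hpa, ha.ne']) ha.symm h₃)
  · by_cases hpb' : p = b₃
    · exact Or.inl (left hpb' hb')
    · exact Or.inr (right hpb')

end FourCycle

/-! ### The ladder -/

section Ladder

variable {n : ℕ}

/-- The vertex in row `i` and column `j` of the grid; the additional vertex if `j ≥ n`. -/
def gridVertex (n : ℕ) (i : Fin 2) (j : ℕ) : Option (Fin 2 × Fin n) :=
  if h : j < n then some (i, ⟨j, h⟩) else none

theorem gridVertex_of_lt {i : Fin 2} {j : ℕ} (h : j < n) :
    gridVertex n i j = some (i, ⟨j, h⟩) := dif_pos h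

theorem gridVertex_of_le {i : Fin 2} {j : ℕ} (h : n ≤ j) : gridVertex n i j = none :=
  dif_neg (by omega)

theorem gridVertex_eq_iff {i i' : Fin 2} {j j' : ℕ} (h : j < n) :
    gridVertex n i j = gridVertex n i' j' ↔ i = i' ∧ j = j' := by
  rw [gridVertex_of_lt h]
  by_cases h' : j' < n
  · simp [gridVertex_of_lt h']
  · rw [gridVertex_of_le (by omega)]
    simp only [reduceCtorEq, false_iff]
    omega

theorem gridVertex_ne_none {i : Fin 2} {j : ℕ} (h : j < n) : gridVertex n i j ≠ none := by
  simp [gridVertex_of_lt h]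

theorem eq_none_or_gridVertex (p : Option (Fin 2 × Fin n)) :
    p = none ∨ ∃ i j, j < n ∧ p = gridVertex n i j := by
  rcases p with _ | ⟨i, j⟩
  · exact Or.inl rfl
  · exact Or.inr ⟨i, j, j.2, (gridVertex_of_lt j.2).symm⟩

theorem adj_rung {i i' : Fin 2} {j : ℕ} (h : j < n) (hi : i ≠ i') :
    (baseGraph n).Adj (gridVertex n i j) (gridVertex n i' j) := by
  rw [gridVertex_of_lt h, gridVertex_of_lt h]
  exact Or.inl ⟨hi, rfl⟩

theorem adj_succ {i : Fin 2} {j : ℕ} (h : j + 1 < n) :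
    (baseGraph n).Adj (gridVertex n i j) (gridVertex n i (j + 1)) := by
  rw [gridVertex_of_lt h, gridVertex_of_lt (by omega)]
  exact Or.inr ⟨rfl, Or.inl rfl⟩

theorem adj_leaf {j : ℕ} (h : j + 1 = n) : (baseGraph n).Adj (gridVertex n 0 j) none := by
  rw [gridVertex_of_lt (by omega)]
  exact ⟨rfl, h⟩

theorem eq_of_adj_leaf {p : Option (Fin 2 × Fin n)} (h : (baseGraph n).Adj none p) :
    p = gridVertex n 0 (n - 1) := by
  rcases p with _ | ⟨i, j⟩
  · exact h.elim
  · obtain ⟨rfl, h⟩ : i = 0 ∧ j.val + 1 = n := h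
    rw [gridVertex_of_lt (by omega)]
    simp only [Option.some.injEq, Prod.mk.injEq, true_and, Fin.ext_iff]
    omega

theorem eq_of_adj_gridVertex {i i' : Fin 2} (hi : i ≠ i') {j : ℕ} (hj : j < n)
    {p : Option (Fin 2 × Fin n)} (h : (baseGraph n).Adj (gridVertex n i j) p) :
    p = gridVertex n i' j ∨ p = gridVertex n i (j + 1) ∨
      (1 ≤ j ∧ p = gridVertex n i (j - 1)) := by
  rw [gridVertex_of_lt hj] at h
  rcases p with _ | ⟨k, l, hl⟩
  · have h : i = 0 ∧ j + 1 = n := h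
    exact Or.inr (Or.inl (gridVertex_of_le (by omega)).symm)
  · have h : (i ≠ k ∧ (⟨j, hj⟩ : Fin n) = ⟨l, hl⟩) ∨ (i = k ∧ (j + 1 = l ∨ l + 1 = j)) := h
    rw [Fin.mk.injEq] at h
    rcases h with ⟨h1, rfl⟩ | ⟨rfl, rfl | rfl⟩
    · left
      rw [gridVertex_of_lt hj, show k = i' by omega]
    · exact Or.inr (Or.inl (gridVertex_of_lt hl).symm)
    · exact Or.inr (Or.inr ⟨by omega, (gridVertex_of_lt hl).symm⟩)

/-- The four edges between the vertices of the columns `x` and `x + 1`. -/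
def cell (n x : ℕ) : Set (Sym2 (Option (Fin 2 × Fin n))) :=
  fourCycle (gridVertex n 0 x) (gridVertex n 1 x) (gridVertex n 1 (x + 1))
    (gridVertex n 0 (x + 1))

theorem rung_mem_cell {i i' : Fin 2} (hi : i ≠ i') (x : ℕ) :
    s(gridVertex n i x, gridVertex n i' x) ∈ cell n x ∧
      s(gridVertex n i (x + 1), gridVertex n i' (x + 1)) ∈ cell n x := by
  unfold cell fourCycle
  fin_cases i <;> fin_cases i' <;> simp_all

theorem mem_cell {i i' : Fin 2} (hi : i ≠ i') {x : ℕ} {e : Sym2 (Option (Fin 2 × Fin n))}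
    (he : e ∈ cell n x) : e = s(gridVertex n i x, gridVertex n i' x) ∨
      e = s(gridVertex n i (x + 1), gridVertex n i' (x + 1)) ∨
      e = s(gridVertex n i x, gridVertex n i (x + 1)) ∨
      e = s(gridVertex n i' x, gridVertex n i' (x + 1)) := by
  simp only [cell, fourCycle, Set.mem_insert_iff, Set.mem_singleton_iff] at he
  rw [Sym2.eq_swap (a := gridVertex n 0 (x + 1)) (b := gridVertex n 0 x),
    Sym2.eq_swap (a := gridVertex n 1 (x + 1)) (b := gridVertex n 0 (x + 1))] at he
  fin_cases i <;> fin_cases i'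
  · exact (hi rfl).elim
  · rcases he with rfl | rfl | rfl | rfl <;> simp
  · rcases he with rfl | rfl | rfl | rfl <;> simp
  · exact (hi rfl).elim

theorem evades_cell {x : ℕ} (hx : x + 1 < n) {q : Option (Fin 2 × Fin n)}
    (h : ∀ i, gridVertex n i x ≠ q ∧ gridVertex n i (x + 1) ≠ q) :
    Evades (baseGraph n) (cell n x) q := by
  have hx' : x < n := by omega
  refine evades_fourCycle (adj_rung hx' (by decide)) (adj_succ hx) (adj_rung hx (by decide))
    (adj_succ hx).symm ?_ ?_ (h 0).1 (h 1).1 (h 1).2 (h 0).2 <;>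
  simp [gridVertex_eq_iff hx']

/-- The cells at distance at least `2 * m` from both ends of the ladder. -/
def InnerCell (n m : ℕ) (S : Set (Sym2 (Option (Fin 2 × Fin n)))) : Prop :=
  ∃ x, 2 * m ≤ x ∧ x + 2 + 2 * m ≤ n ∧ S = cell n x

theorem exists_other_row (i : Fin 2) : ∃ i' : Fin 2, i ≠ i' := ⟨i + 1, by revert i; decide⟩

/-- If `q` is not on the cell, the error stays there. Otherwise it is moved to a rung next to the
column of `q`, and the cell beyond this rung avoids `q`. The new cell is at most two columns away,
which is the price of one iteration in `InnerCell`. -/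
theorem innerCell_step {m : ℕ} {S : Set (Sym2 (Option (Fin 2 × Fin n)))}
    (hS : InnerCell n (m + 1) S) (p q : Option (Fin 2 × Fin n)) {e} (he : e ∈ S)
    (hne : e ≠ s(p, q)) :
    ∃ S', InnerCell n m S' ∧ Evades (baseGraph n) S' q ∧
      ∃ e' ∈ S', Moves (baseGraph n) {p, q} e e' := by
  obtain ⟨x, hx₁, hx₂, rfl⟩ := hS
  by_cases hq : ∀ i, gridVertex n i x ≠ q ∧ gridVertex n i (x + 1) ≠ q
  · exact ⟨_, ⟨x, by omega, by omega, rfl⟩, evades_cell (by omega) hq, e, he, Moves.refl _ _⟩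
  · obtain ⟨y, rfl⟩ : ∃ y, x = y + 2 := ⟨x - 2, by omega⟩
    simp only [not_forall, not_and_or, not_not] at hq
    obtain ⟨i, hq⟩ := hq
    obtain ⟨i', hi⟩ := exists_other_row i
    have far : ∀ {z k : ℕ}, z + 1 < n → k ≠ z → k ≠ z + 1 →
        Evades (baseGraph n) (cell n z) (gridVertex n i k) := fun hz h1 h2 =>
      evades_cell hz fun l => by
        rw [Ne, Ne, gridVertex_eq_iff hz, gridVertex_eq_iff (by omega)]
        omega
    rcases mem_cell hi he, hq with ⟨he', rfl | rfl⟩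
    -- Here `q` is in the left column `y + 2` of the cell; the rungs are those in columns `y + 1`,
    -- `y + 2`, `y + 3`. In the other case the ladder is read from right to left.
    · rcases moves_to_rung (adj_rung (by omega) hi) (adj_rung (by omega) hi)
        (adj_rung (by omega) hi) (adj_succ (by omega)) (adj_succ (j := y + 1) (by omega))
        (adj_succ (by omega)) (by rw [Ne, gridVertex_eq_iff (by omega)]; omega)
        (by rw [Ne, gridVertex_eq_iff (by omega)]; omega)
        (by rw [Ne, gridVertex_eq_iff (by omega)]; omega) he' hne with h | h
      · exact ⟨_, ⟨y, by omega, by omega, rfl⟩, far (by omega) (by omega) (by omega), _,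
          (rung_mem_cell hi y).2, h⟩
      · exact ⟨_, ⟨y + 3, by omega, by omega, rfl⟩, far (by omega) (by omega) (by omega), _,
          (rung_mem_cell hi _).1, h⟩
    · have he'' : e = s(gridVertex n i (y + 2 + 1), gridVertex n i' (y + 2 + 1)) ∨
          e = s(gridVertex n i (y + 2), gridVertex n i' (y + 2)) ∨
          e = s(gridVertex n i (y + 2 + 1), gridVertex n i (y + 2)) ∨
          e = s(gridVertex n i' (y + 2 + 1), gridVertex n i' (y + 2)) := by
        rw [Sym2.eq_swap (a := gridVertex n i (y + 2 + 1)) (b := gridVertex n i (y + 2)),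
          Sym2.eq_swap (a := gridVertex n i' (y + 2 + 1)) (b := gridVertex n i' (y + 2))]
        tauto
      rcases moves_to_rung (adj_rung (by omega) hi) (adj_rung (by omega) hi)
        (adj_rung (by omega) hi) (adj_succ (by omega)).symm
        (adj_succ (j := y + 3) (by omega)).symm
        (adj_succ (by omega)).symm (by rw [Ne, gridVertex_eq_iff (by omega)]; omega)
        (by rw [Ne, gridVertex_eq_iff (by omega)]; omega)
        (by rw [Ne, gridVertex_eq_iff (by omega)]; omega) he'' hne with h | h
      · exact ⟨_, ⟨y + 4, by omega, by omega, rfl⟩, far (by omega) (by omega) (by omega), _,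
          (rung_mem_cell hi _).1, h⟩
      · exact ⟨_, ⟨y + 1, by omega, by omega, rfl⟩, far (by omega) (by omega) (by omega), _,
          (rung_mem_cell hi _).2, h⟩

/-! ### Moving the error along the ladder with no gadget frozen -/

theorem moves_rung_succ {i : Fin 2} {j : ℕ} (h : j + 1 < n) :
    Moves (baseGraph n) ∅ s(gridVertex n i j, gridVertex n i (j + 1))
      s(gridVertex n 0 j, gridVertex n 1 j) := by
  fin_cases i
  · exact moves_of_adj (Set.notMem_empty _) (adj_succ h) (adj_rung (by omega) (by decide))
  · rw [Sym2.eq_swap (a := gridVertex n 0 j)]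
    exact moves_of_adj (Set.notMem_empty _) (adj_succ h) (adj_rung (by omega) (by decide))

theorem moves_rung_zero {j : ℕ} (h : j < n) :
    Moves (baseGraph n) ∅ s(gridVertex n 0 j, gridVertex n 1 j)
      s(gridVertex n 0 0, gridVertex n 1 0) ∧
    Moves (baseGraph n) ∅ s(gridVertex n 0 0, gridVertex n 1 0)
      s(gridVertex n 0 j, gridVertex n 1 j) := by
  induction j with
  | zero => exact ⟨Moves.refl _ _, Moves.refl _ _⟩
  | succ j ih =>
    have hs := adj_succ (i := 0) h
    have hr := adj_rung (n := n) (i := 0) (i' := 1) (j := j) (by omega) (by decide)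
    have hr' := adj_rung (n := n) (i := 0) (i' := 1) h (by decide)
    have hne : ∀ v : Option (Fin 2 × Fin n), v ∉ (∅ : Set _) := Set.notMem_empty
    constructor
    · refine Moves.trans ?_ (ih (by omega)).1
      refine (moves_of_adj (hne _) hr' hs.symm).trans ?_
      rw [Sym2.eq_swap]
      exact moves_of_adj (hne _) hs hr
    · refine (ih (by omega)).2.trans ?_
      refine (moves_of_adj (hne _) hr hs).trans ?_
      rw [Sym2.eq_swap]
      exact moves_of_adj (hne _) hs.symm hr'

theorem moves_to_rung_zero (hn : 0 < n) {p q : Option (Fin 2 × Fin n)}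
    (h : (baseGraph n).Adj p q) :
    Moves (baseGraph n) ∅ s(p, q) s(gridVertex n 0 0, gridVertex n 1 0) := by
  have hleaf : ∀ {q : Option (Fin 2 × Fin n)}, (baseGraph n).Adj none q →
      Moves (baseGraph n) ∅ s(none, q) s(gridVertex n 0 0, gridVertex n 1 0) := by
    intro q h
    obtain rfl := eq_of_adj_leaf h
    refine Moves.trans ?_ (moves_rung_zero (j := n - 1) (by omega)).1
    rw [Sym2.eq_swap]
    exact moves_of_adj (Set.notMem_empty _) h.symm (adj_rung (by omega) (by decide))
  rcases eq_none_or_gridVertex p with rfl | ⟨i, j, hj, rfl⟩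
  · exact hleaf h
  · obtain ⟨i', hi⟩ := exists_other_row i
    rcases eq_of_adj_gridVertex hi hj h with rfl | rfl | ⟨h1, rfl⟩
    · refine Moves.trans ?_ (moves_rung_zero hj).1
      fin_cases i <;> fin_cases i'
      · exact (hi rfl).elim
      · exact Moves.refl _ _
      · rw [Sym2.eq_swap]
        exact Moves.refl _ _
      · exact (hi rfl).elim
    · by_cases hj' : j + 1 < n
      · exact (moves_rung_succ hj').trans (moves_rung_zero hj).1
      · rw [gridVertex_of_le (i := i) (j := j + 1) (by omega), Sym2.eq_swap]
        rw [gridVertex_of_le (i := i) (j := j + 1) (by omega)] at h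
        exact hleaf h.symm
    · obtain ⟨j, rfl⟩ : ∃ k, j = k + 1 := ⟨j - 1, by omega⟩
      rw [Sym2.eq_swap]
      exact (moves_rung_succ hj).trans (moves_rung_zero (by omega)).1

theorem hidingFamily_innerCell (hn : 0 < n) (e : (baseGraph n).edgeSet) :
    HidingFamily (baseGraph n) (edgeIndicator e.1) (InnerCell n) := by
  have hsol : ∀ j, j < n → ∃ f : Switching (baseGraph n),
      f.SolvesExcept (edgeIndicator e.1) s(gridVertex n 0 j, gridVertex n 1 j) := by
    intro j hj
    -- The empty switching is wrong exactly at the twisted edge; from there the error can be brought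
    -- to any rung.
    have h0 : (⟨fun _ _ => 0, fun _ _ _ => rfl, fun _ => Finset.sum_const_zero⟩ :
        Switching (baseGraph n)).SolvesExcept (edgeIndicator e.1) e.1 := fun p r _ => by
      rw [CharTwo.add_self_eq_zero, CharTwo.add_self_eq_zero]
    have hm : Moves (baseGraph n) ∅ e.1 s(gridVertex n 0 0, gridVertex n 1 0) := by
      obtain ⟨e, he⟩ := e
      induction e with | _ p q =>
      exact moves_to_rung_zero hn he
    obtain ⟨f, hf, -⟩ := (hm.trans (moves_rung_zero hj).2) _ _ h0
    exact ⟨f, hf⟩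
  refine ⟨?_, fun m S hS p q e he hne => innerCell_step hS p q he hne⟩
  rintro m S ⟨x, -, hx, rfl⟩ p q
  have hr := rung_mem_cell (n := n) (i := 0) (i' := 1) (by decide) x
  by_cases h : s(gridVertex n 0 x, gridVertex n 1 x) = s(p, q)
  · refine ⟨_, hr.2, ?_, hsol _ (by omega)⟩
    rw [← h, Ne, Sym2.eq_iff]
    simp [gridVertex_eq_iff (n := n) (j := x + 1) (by omega)]
  · exact ⟨_, hr.1, h, hsol _ (by omega)⟩

theorem not_distinguishesIn_of_le {r : ColouringOperator} (hr : IsWalkOperator r) {m : ℕ}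
    (hm : 4 * m + 2 ≤ n) (e : (baseGraph n).edgeSet) :
    ¬ DistinguishesIn r m (cfi (baseGraph n)) (cfiTwisted (baseGraph n) e) := by
  rw [cfi_eq_twistGraph, cfiTwisted_eq_twistGraph]
  refine not_distinguishesIn (good := InnerCell n) ?_ hr ⟨2 * m, le_rfl, by omega, rfl⟩
  rw [zero_add]
  exact hidingFamily_innerCell (by omega) e

end Ladder

/-! ### Consequences of stability -/

section Stable

variable {V V' C : Type} [Fintype V] [Fintype V']

theorem kWalkRefinement_two (χ : V → V → C) (u v : V) :
    kWalkRefinement 2 V C χ u v = (Finset.univ : Finset V).val.map fun w => [χ u w, χ w v] := by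
  rw [kWalkRefinement_succ]
  simp only [zero_add, kWalkRefinement_one, Multiset.map_singleton]
  exact Multiset.bind_singleton _ _

namespace StablePair

variable {H : SimpleGraph V} {H' : SimpleGraph V'} {χ : V → V → C} {χ' : V' → V' → C}

/-- The third pebble: walks with two steps answer every intermediate vertex `w`. -/
theorem exists_between (h : StablePair H H' χ χ') {u v : V} {u' v' : V'}
    (e : χ u v = χ' u' v') (w : V) : ∃ w', χ u w = χ' u' w' ∧ χ w v = χ' w' v' := by
  have hm : [χ u w, χ w v] ∈ kWalkRefinement 2 V C χ u v := by
    rw [kWalkRefinement_two]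
    exact Multiset.mem_map_of_mem _ (Finset.mem_univ w)
  rw [h.walk e, kWalkRefinement_two] at hm
  obtain ⟨w', -, hw⟩ := Multiset.mem_map.1 hm
  simp only [List.cons.injEq, and_true] at hw
  exact ⟨w', hw.1.symm, hw.2.symm⟩

theorem loop_left (h : StablePair H H' χ χ') {u v : V} {u' v' : V'}
    (e : χ u v = χ' u' v') : χ u u = χ' u' u' := by
  obtain ⟨w, hw, -⟩ := h.exists_between e u
  have := (eq_iff_of_initialColouring_eq (h.init hw)).1 rfl
  rwa [← this] at hw

theorem loop_right (h : StablePair H H' χ χ') {u v : V} {u' v' : V'}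
    (e : χ u v = χ' u' v') : χ v v = χ' v' v' := by
  obtain ⟨w, -, hw⟩ := h.exists_between e v
  have := (eq_iff_of_initialColouring_eq (h.init hw)).1 rfl
  rwa [this] at hw

theorem adj_iff (h : StablePair H H' χ χ') {u v : V} {u' v' : V'}
    (e : χ u v = χ' u' v') : H.Adj u v ↔ H'.Adj u' v' :=
  adj_iff_of_initialColouring_eq (h.init e)

theorem exists_adj (h : StablePair H H' χ χ') {u w : V} {u' : V'}
    (e : χ u u = χ' u' u') (hw : H.Adj u w) : ∃ w', H'.Adj u' w' ∧ χ w w = χ' w' w' := by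
  obtain ⟨w', h', -⟩ := h.exists_between e w
  exact ⟨w', (h.adj_iff h').1 hw, h.loop_right h'⟩

open Classical in
theorem card_adj_eq (h : StablePair H H' χ χ') {u : V} {u' : V'} (e : χ u u = χ' u' u') :
    (Finset.univ.filter (H.Adj u)).card = (Finset.univ.filter (H'.Adj u')).card := by
  -- Stable colours determine adjacency, so the neighbours can be counted by the first entries of
  -- the walk colours.
  let P : List C → Prop := fun l => ∃ x y c, H'.Adj x y ∧ l = [χ' x y, c]
  have h1 : ∀ w, P [χ u w, χ w u] ↔ H.Adj u w := fun w => by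
    constructor
    · rintro ⟨x, y, c, hxy, hl⟩
      exact (h.adj_iff (List.cons.inj hl).1).2 hxy
    · intro hw
      obtain ⟨x, y, hxy⟩ := h.left u w
      exact ⟨x, y, _, (h.adj_iff hxy).1 hw, by rw [hxy]⟩
  have h2 : ∀ w, P [χ' u' w, χ' w u'] ↔ H'.Adj u' w := fun w => by
    constructor
    · rintro ⟨x, y, c, hxy, hl⟩
      obtain ⟨a, b, hab⟩ := h.right x y
      exact (h.adj_iff (hab.trans (List.cons.inj hl).1.symm)).1 ((h.adj_iff hab).2 hxy)
    · exact fun hw => ⟨u', w, _, hw, rfl⟩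
  have := congrArg (Multiset.countP P) (h.walk e)
  rw [kWalkRefinement_two, kWalkRefinement_two, Multiset.countP_map, Multiset.countP_map] at this
  simp only [h1, h2] at this
  exact this

end StablePair

end Stable

/-! ### Degrees -/

section Degrees

variable {B : Type} [Fintype B] [DecidableEq B] {G : SimpleGraph B} [DecidableRel G.Adj]
  {t : Sym2 B → ZMod 2}

/-- Even parity determines the last component. -/
theorem vertex_ext_of_ne {x y : CFIVertex G} (h : x.1 = y.1) (r : B)
    (hc : ∀ r' ≠ r, comp x r' = comp y r') : x = y := by
  refine vertex_ext h fun r' => ?_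
  by_cases hr : r' = r
  · subst hr
    have h1 := sum_comp x
    have h2 := sum_comp y
    rw [← Finset.add_sum_erase _ _ (Finset.mem_univ r')] at h1 h2
    rw [Finset.sum_congr rfl fun r hr => hc r (Finset.ne_of_mem_erase hr)] at h1
    exact add_right_cancel (h1.trans h2.symm)
  · exact hc r' hr

theorem exists_vertex (p : B) : ∃ x : CFIVertex G, x.1 = p :=
  ⟨mkVertex p 0 (fun _ _ => rfl) (by simp), rfl⟩

theorem exists_vertex_comp {q p r : B} (hp : G.Adj q p) (hr : G.Adj q r) (hne : p ≠ r)
    (a : ZMod 2) : ∃ x : CFIVertex G, x.1 = q ∧ comp x p = a := by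
  refine ⟨mkVertex q (Pi.single p a + Pi.single r a) (fun s hs => ?_) ?_, rfl, ?_⟩
  · rw [Pi.add_apply, Pi.single_eq_of_ne, Pi.single_eq_of_ne, add_zero] <;> rintro rfl <;>
      contradiction
  · simp only [Pi.add_apply, Finset.sum_add_distrib, Finset.sum_pi_single', Finset.mem_univ,
      if_true]
    exact CharTwo.add_self_eq_zero a
  · simp [hne]

/-- A third neighbour `s` absorbs the parity, so two components can be prescribed freely. -/
theorem exists_vertex_comp_comp {q p r s : B} (hp : G.Adj q p) (hr : G.Adj q r)
    (hs : G.Adj q s) (hpr : p ≠ r) (hps : p ≠ s) (hrs : r ≠ s)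
    (a b : ZMod 2) : ∃ x : CFIVertex G, x.1 = q ∧ comp x p = a ∧ comp x r = b := by
  refine ⟨mkVertex q (Pi.single p a + Pi.single r b + Pi.single s (a + b)) (fun c hc => ?_) ?_,
    rfl, ?_, ?_⟩
  · rw [Pi.add_apply, Pi.add_apply, Pi.single_eq_of_ne, Pi.single_eq_of_ne, Pi.single_eq_of_ne,
      add_zero, add_zero] <;> rintro rfl <;> contradiction
  · simp only [Pi.add_apply, Finset.sum_add_distrib, Finset.sum_pi_single', Finset.mem_univ,
      if_true]
    exact CharTwo.add_self_eq_zero (a + b)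
  · simp [hpr, hps]
  · simp [hpr.symm, hrs]

open Classical in
/-- The number of neighbours of `x` in `twistGraph G t`. -/
noncomputable def twistDegree (t : Sym2 B → ZMod 2) (x : CFIVertex G) : ℕ :=
  (Finset.univ.filter ((twistGraph G t).Adj x)).card

open Classical in
/-- The neighbours of `x` in the gadget of `q`. -/
noncomputable def gadgetNeighbors (t : Sym2 B → ZMod 2) (x : CFIVertex G) (q : B) :
    Finset (CFIVertex G) :=
  Finset.univ.filter fun y => (twistGraph G t).Adj x y ∧ y.1 = q

theorem mem_gadgetNeighbors {x y : CFIVertex G} {q : B} :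
    y ∈ gadgetNeighbors t x q ↔ (twistGraph G t).Adj x y ∧ y.1 = q := by
  simp [gadgetNeighbors]

theorem adj_of_comp_eq {x y : CFIVertex G} (h : G.Adj x.1 y.1)
    (hc : comp y x.1 = comp x y.1 + t s(x.1, y.1)) : (twistGraph G t).Adj x y := by
  refine ⟨h, ?_⟩
  rw [hc, ← add_assoc, CharTwo.add_self_eq_zero, zero_add]

theorem comp_eq_of_adj {x y : CFIVertex G} (h : (twistGraph G t).Adj x y) :
    comp y x.1 = comp x y.1 + t s(x.1, y.1) := by
  rw [← h.2, ← add_assoc, CharTwo.add_self_eq_zero, zero_add]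

theorem one_le_card_gadgetNeighbors {x : CFIVertex G} {q r : B} (hq : G.Adj x.1 q)
    (hr : G.Adj q r) (hne : x.1 ≠ r) : 1 ≤ (gadgetNeighbors t x q).card := by
  obtain ⟨y, rfl, hy⟩ := exists_vertex_comp hq.symm hr hne (comp x q + t s(x.1, q))
  exact Finset.card_pos.2 ⟨y, mem_gadgetNeighbors.2 ⟨adj_of_comp_eq hq hy, rfl⟩⟩

theorem two_le_card_gadgetNeighbors {x : CFIVertex G} {q r s : B} (hq : G.Adj x.1 q)
    (hr : G.Adj q r) (hs : G.Adj q s) (hxr : x.1 ≠ r) (hxs : x.1 ≠ s) (hrs : r ≠ s) :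
    2 ≤ (gadgetNeighbors t x q).card := by
  obtain ⟨y, hy, hyx, hyr⟩ := exists_vertex_comp_comp hq.symm hr hs hxr hxs hrs
    (comp x q + t s(x.1, q)) 0
  obtain ⟨z, hz, hzx, hzr⟩ := exists_vertex_comp_comp hq.symm hr hs hxr hxs hrs
    (comp x q + t s(x.1, q)) 1
  refine Finset.one_lt_card.2 ⟨y, mem_gadgetNeighbors.2 ⟨?_, hy⟩, z,
    mem_gadgetNeighbors.2 ⟨?_, hz⟩, ?_⟩
  · subst hy
    exact adj_of_comp_eq hq hyx
  · subst hz
    exact adj_of_comp_eq hq hzx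
  · rintro rfl
    exact zero_ne_one (hyr.symm.trans hzr)

/-- Adjacency to `x` fixes the component towards `x`, and parity fixes the one at `s`; only the
component at `r` is free. -/
theorem card_gadgetNeighbors_le_two {x : CFIVertex G} {q r s : B}
    (h : ∀ c, G.Adj q c → c = x.1 ∨ c = r ∨ c = s) : (gadgetNeighbors t x q).card ≤ 2 := by
  have := Finset.card_le_card_of_injOn (s := gadgetNeighbors t x q)
    (t := (Finset.univ : Finset (ZMod 2))) (fun y => comp y r) (fun _ _ => Finset.mem_univ _) ?_
  · exact this.trans (by simp)
  · intro y hy z hz hyz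
    obtain ⟨hya, rfl⟩ := mem_gadgetNeighbors.1 hy
    obtain ⟨hza, hzy⟩ := mem_gadgetNeighbors.1 hz
    refine vertex_ext_of_ne hzy.symm s fun c hc => ?_
    by_cases hadj : G.Adj y.1 c
    · rcases h c hadj with rfl | rfl | rfl
      · rw [comp_eq_of_adj hya, comp_eq_of_adj hza, hzy]
      · exact hyz
      · exact (hc rfl).elim
    · rw [comp_of_not_adj hadj, comp_of_not_adj (by rwa [hzy])]

theorem card_gadgetNeighbors_le_one {x : CFIVertex G} {q r : B}
    (h : ∀ c, G.Adj q c → c = x.1 ∨ c = r) : (gadgetNeighbors t x q).card ≤ 1 := by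
  refine Finset.card_le_one.2 fun y hy z hz => ?_
  obtain ⟨hya, rfl⟩ := mem_gadgetNeighbors.1 hy
  obtain ⟨hza, hzy⟩ := mem_gadgetNeighbors.1 hz
  refine vertex_ext_of_ne hzy.symm r fun c hc => ?_
  by_cases hadj : G.Adj y.1 c
  · rcases h c hadj with rfl | rfl
    · rw [comp_eq_of_adj hya, comp_eq_of_adj hza, hzy]
    · exact (hc rfl).elim
  · rw [comp_of_not_adj hadj, comp_of_not_adj (by rwa [hzy])]

theorem sum_card_gadgetNeighbors_le (x : CFIVertex G) (S : Finset B) :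
    ∑ q ∈ S, (gadgetNeighbors t x q).card ≤ twistDegree t x := by
  classical
  rw [← Finset.card_biUnion]
  · refine Finset.card_le_card fun y hy => ?_
    obtain ⟨q, -, hy⟩ := Finset.mem_biUnion.1 hy
    simpa using (mem_gadgetNeighbors.1 hy).1
  · intro p _ q _ hpq
    refine Finset.disjoint_left.2 fun y hy hy' => hpq ?_
    rw [← (mem_gadgetNeighbors.1 hy).2, ← (mem_gadgetNeighbors.1 hy').2]

theorem twistDegree_le_sum (x : CFIVertex G) (S : Finset B)
    (h : ∀ y, (twistGraph G t).Adj x y → y.1 ∈ S) :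
    twistDegree t x ≤ ∑ q ∈ S, (gadgetNeighbors t x q).card := by
  classical
  refine le_trans (Finset.card_le_card fun y hy => ?_) Finset.card_biUnion_le
  have hy : (twistGraph G t).Adj x y := by simpa using hy
  exact Finset.mem_biUnion.2 ⟨y.1, h y hy, mem_gadgetNeighbors.2 ⟨hy, rfl⟩⟩

end Degrees

/-! ### Recognizing the base vertices -/

section Pin

variable {n : ℕ} {t t' : Sym2 (Option (Fin 2 × Fin n)) → ZMod 2}

theorem adj_right {i : Fin 2} {j : ℕ} (h : j < n) (h' : j + 1 < n ∨ i = 0) :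
    (baseGraph n).Adj (gridVertex n i j) (gridVertex n i (j + 1)) := by
  by_cases hj : j + 1 < n
  · exact adj_succ hj
  · obtain rfl : i = 0 := h'.resolve_left hj
    rw [gridVertex_of_le (by omega : n ≤ j + 1)]
    exact adj_leaf (by omega)

theorem adj_left {i : Fin 2} {j : ℕ} (h : j < n) (h' : 1 ≤ j) :
    (baseGraph n).Adj (gridVertex n i j) (gridVertex n i (j - 1)) := by
  have := (adj_succ (n := n) (i := i) (j := j - 1) (by omega)).symm
  rwa [Nat.sub_add_cancel h'] at this

theorem gridVertex_row_ne {i i' : Fin 2} (hi : i ≠ i') {j j' : ℕ} (h : j < n) :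
    gridVertex n i j ≠ gridVertex n i' j' :=
  fun he => hi ((gridVertex_eq_iff h).1 he).1

theorem gridVertex_succ_ne_pred {i : Fin 2} {j : ℕ} (h : j < n) :
    gridVertex n i (j + 1) ≠ gridVertex n i (j - 1) := by
  rw [ne_comm, Ne, gridVertex_eq_iff (by omega)]
  omega

theorem one_le_card_gadgetNeighbors_grid (hn : 2 ≤ n)
    {x : CFIVertex (baseGraph n)} {i : Fin 2} {j : ℕ} (hj : j < n)
    (h : (baseGraph n).Adj x.1 (gridVertex n i j)) :
    1 ≤ (gadgetNeighbors t x (gridVertex n i j)).card := by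
  obtain ⟨i', hi⟩ := exists_other_row i
  by_cases hx : x.1 = gridVertex n i' j
  · by_cases hj' : j + 1 < n
    · exact one_le_card_gadgetNeighbors h (adj_succ hj')
        (hx ▸ gridVertex_row_ne hi.symm hj)
    · exact one_le_card_gadgetNeighbors h (adj_left hj (by omega))
        (hx ▸ gridVertex_row_ne hi.symm hj)
  · exact one_le_card_gadgetNeighbors h (adj_rung hj hi) hx

theorem two_le_card_gadgetNeighbors_grid
    {x : CFIVertex (baseGraph n)} {i : Fin 2} {j : ℕ} (hj : j < n) (h1 : 1 ≤ j)
    (h2 : j + 1 < n ∨ i = 0) (h : (baseGraph n).Adj x.1 (gridVertex n i j)) :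
    2 ≤ (gadgetNeighbors t x (gridVertex n i j)).card := by
  obtain ⟨i', hi⟩ := exists_other_row i
  have d₁ : gridVertex n i' j ≠ gridVertex n i (j + 1) := gridVertex_row_ne hi.symm hj
  have d₂ : gridVertex n i' j ≠ gridVertex n i (j - 1) := gridVertex_row_ne hi.symm hj
  have d₃ := gridVertex_succ_ne_pred (i := i) hj
  rcases eq_of_adj_gridVertex hi hj h.symm with hx | hx | ⟨-, hx⟩
  · exact two_le_card_gadgetNeighbors h (adj_right hj h2) (adj_left hj h1) (hx ▸ d₁) (hx ▸ d₂) d₃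
  · exact two_le_card_gadgetNeighbors h (adj_rung hj hi) (adj_left hj h1) (hx ▸ d₁.symm)
      (hx ▸ d₃) d₂
  · exact two_le_card_gadgetNeighbors h (adj_rung hj hi) (adj_right hj h2) (hx ▸ d₂.symm)
      (hx ▸ d₃.symm) d₁

theorem card_gadgetNeighbors_grid_le_two
    {x : CFIVertex (baseGraph n)} {i : Fin 2} {j : ℕ} (hj : j < n)
    (h : (baseGraph n).Adj x.1 (gridVertex n i j)) :
    (gadgetNeighbors t x (gridVertex n i j)).card ≤ 2 := by
  obtain ⟨i', hi⟩ := exists_other_row i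
  have key : ∀ c, (baseGraph n).Adj (gridVertex n i j) c → c = gridVertex n i' j ∨
      c = gridVertex n i (j + 1) ∨ c = gridVertex n i (j - 1) := fun c hc => by
    have := eq_of_adj_gridVertex hi hj hc
    tauto
  rcases key _ h.symm with hx | hx | hx
  · exact card_gadgetNeighbors_le_two fun c hc => by
      rw [hx]
      exact key c hc
  · exact card_gadgetNeighbors_le_two (r := gridVertex n i' j) (s := gridVertex n i (j - 1))
      fun c hc => by
        rw [hx]
        have := key c hc
        tauto
  · exact card_gadgetNeighbors_le_two (r := gridVertex n i' j) (s := gridVertex n i (j + 1))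
      fun c hc => by
        rw [hx]
        have := key c hc
        tauto

theorem twistDegree_leaf_le (hn : 1 ≤ n) {x : CFIVertex (baseGraph n)} (hx : x.1 = none) :
    twistDegree t x ≤ 2 := by
  refine (twistDegree_le_sum x {gridVertex n 0 (n - 1)} fun y hy => ?_).trans ?_
  · rw [Finset.mem_singleton]
    exact eq_of_adj_leaf (hx ▸ hy.1)
  · rw [Finset.sum_singleton]
    refine card_gadgetNeighbors_grid_le_two (by omega) ?_
    rw [hx]
    exact (adj_leaf (by omega)).symm

theorem le_twistDegree_of_pair {x : CFIVertex (baseGraph n)} {p q : Option (Fin 2 × Fin n)}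
    (hpq : p ≠ q) {a b : ℕ} (hp : a ≤ (gadgetNeighbors t x p).card)
    (hq : b ≤ (gadgetNeighbors t x q).card) : a + b ≤ twistDegree t x := by
  have := sum_card_gadgetNeighbors_le (t := t) x {p, q}
  rw [Finset.sum_pair hpq] at this
  omega

theorem le_twistDegree_of_triple {x : CFIVertex (baseGraph n)} {p q r : Option (Fin 2 × Fin n)}
    (hpq : p ≠ q) (hpr : p ≠ r) (hqr : q ≠ r) {a b c : ℕ}
    (hp : a ≤ (gadgetNeighbors t x p).card) (hq : b ≤ (gadgetNeighbors t x q).card)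
    (hr : c ≤ (gadgetNeighbors t x r).card) : a + (b + c) ≤ twistDegree t x := by
  have := sum_card_gadgetNeighbors_le (t := t) x {p, q, r}
  rw [Finset.sum_insert (by simp [hpq, hpr]), Finset.sum_pair hqr] at this
  omega

theorem three_le_twistDegree (hn : 3 ≤ n) {x : CFIVertex (baseGraph n)} (hx : x.1 ≠ none) :
    3 ≤ twistDegree t x := by
  rcases eq_none_or_gridVertex x.1 with h | ⟨i, j, hj, h⟩
  · exact (hx h).elim
  obtain ⟨i', hi⟩ := exists_other_row i
  have hr : 1 ≤ (gadgetNeighbors t x (gridVertex n i' j)).card :=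
    one_le_card_gadgetNeighbors_grid (by omega) hj (h ▸ adj_rung hj hi)
  have d₁ : gridVertex n i' j ≠ gridVertex n i (j + 1) := gridVertex_row_ne hi.symm hj
  have d₂ : gridVertex n i' j ≠ gridVertex n i (j - 1) := gridVertex_row_ne hi.symm hj
  rcases Nat.eq_zero_or_pos j with h0 | h0
  · exact le_twistDegree_of_pair d₁ hr (two_le_card_gadgetNeighbors_grid (by omega) (by omega)
      (Or.inl (by omega)) (h ▸ adj_succ (by omega)))
  · by_cases hj' : j + 1 < n
    · exact le_twistDegree_of_triple d₁ d₂ (gridVertex_succ_ne_pred hj) hr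
        (one_le_card_gadgetNeighbors_grid (by omega) hj' (h ▸ adj_succ hj'))
        (one_le_card_gadgetNeighbors_grid (by omega) (by omega) (h ▸ adj_left hj h0))
    · exact le_twistDegree_of_pair d₂ hr (two_le_card_gadgetNeighbors_grid (by omega) (by omega)
        (Or.inl (by omega)) (h ▸ adj_left hj h0))

/-- The pendant vertex gives the row `0` corner of the last column degree three, so its gadget
contributes two neighbours; in row `1` the corresponding contribution guaranteed below is only one.
-/
theorem five_le_twistDegree (hn : 3 ≤ n) {x : CFIVertex (baseGraph n)}
    (hx : x.1 = gridVertex n 0 (n - 2)) : 5 ≤ twistDegree t x := by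
  have hj : n - 2 < n := by omega
  refine le_twistDegree_of_triple (a := 2) (b := 2) (c := 1)
    (gridVertex_row_ne (i := 1) (by decide) hj) (gridVertex_row_ne (by decide) hj)
    (gridVertex_succ_ne_pred hj)
    (two_le_card_gadgetNeighbors_grid hj (by omega) (Or.inl (by omega)) ?_)
    (two_le_card_gadgetNeighbors_grid (by omega) (by omega) (Or.inr rfl) ?_)
    (one_le_card_gadgetNeighbors_grid (by omega) (by omega) ?_)
  · exact hx ▸ adj_rung hj (by decide)
  · exact hx ▸ adj_succ (by omega)
  · exact hx ▸ adj_left hj (by omega)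

theorem four_le_twistDegree (hn : 3 ≤ n) {x : CFIVertex (baseGraph n)}
    (hx : x.1 = gridVertex n 1 (n - 2)) : 4 ≤ twistDegree t x := by
  have hj : n - 2 < n := by omega
  refine le_twistDegree_of_triple (a := 2) (b := 1) (c := 1)
    (gridVertex_row_ne (i := 0) (i' := 1) (by decide) hj) (gridVertex_row_ne (by decide) hj)
    (gridVertex_succ_ne_pred hj)
    (two_le_card_gadgetNeighbors_grid hj (by omega) (Or.inl (by omega)) ?_)
    (one_le_card_gadgetNeighbors_grid (by omega) (by omega) ?_)
    (one_le_card_gadgetNeighbors_grid (by omega) (by omega) ?_)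
  · exact hx ▸ adj_rung hj (by decide)
  · exact hx ▸ adj_succ (by omega)
  · exact hx ▸ adj_left hj (by omega)

theorem eq_of_adj_corner (hn : 3 ≤ n) {c : Option (Fin 2 × Fin n)}
    (h : (baseGraph n).Adj (gridVertex n 1 (n - 1)) c) :
    c = gridVertex n 0 (n - 1) ∨ c = gridVertex n 1 (n - 2) := by
  rcases eq_of_adj_gridVertex (i' := 0) (by decide) (by omega) h with rfl | rfl | ⟨-, rfl⟩
  · exact Or.inl rfl
  · rw [gridVertex_of_le (j := n - 1 + 1) (by omega)] at h
    exact (gridVertex_row_ne (i := 1) (i' := 0) (by decide) (by omega)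
      (eq_of_adj_leaf h.symm)).elim
  · exact Or.inr rfl

theorem eq_of_adj_corner' (hn : 3 ≤ n) {c : Option (Fin 2 × Fin n)}
    (h : (baseGraph n).Adj (gridVertex n 0 (n - 1)) c) :
    c = none ∨ c = gridVertex n 1 (n - 1) ∨ c = gridVertex n 0 (n - 2) := by
  rcases eq_of_adj_gridVertex (i' := 1) (by decide) (by omega) h with rfl | rfl | ⟨-, rfl⟩
  · exact Or.inr (Or.inl rfl)
  · exact Or.inl (gridVertex_of_le (by omega))
  · exact Or.inr (Or.inr rfl)

theorem twistDegree_corner_le (hn : 3 ≤ n) {x : CFIVertex (baseGraph n)}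
    (hx : x.1 = gridVertex n 1 (n - 1)) : twistDegree t x ≤ 4 := by
  refine (twistDegree_le_sum x {gridVertex n 0 (n - 1), gridVertex n 1 (n - 2)} fun y hy => ?_).trans
    ?_
  · simpa using eq_of_adj_corner hn (hx ▸ hy.1)
  · rw [Finset.sum_pair (gridVertex_row_ne (by decide) (by omega))]
    refine add_le_add (card_gadgetNeighbors_grid_le_two (by omega) ?_)
      (card_gadgetNeighbors_grid_le_two (by omega) ?_)
    · exact hx ▸ adj_rung (by omega) (by decide)
    · exact hx ▸ adj_left (by omega) (by omega)

theorem twistDegree_corner_le' (hn : 3 ≤ n) {x : CFIVertex (baseGraph n)}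
    (hx : x.1 = gridVertex n 0 (n - 1))
    (hl : ∀ y, (twistGraph (baseGraph n) t).Adj x y → y.1 ≠ none) : twistDegree t x ≤ 3 := by
  refine (twistDegree_le_sum x {gridVertex n 0 (n - 2), gridVertex n 1 (n - 1)} fun y hy => ?_).trans
    ?_
  · have := eq_of_adj_corner' hn (hx ▸ hy.1)
    have := hl y hy
    simp
    tauto
  · rw [Finset.sum_pair (gridVertex_row_ne (by decide) (by omega))]
    refine add_le_add (card_gadgetNeighbors_grid_le_two (by omega) ?_)
      (card_gadgetNeighbors_le_one (r := gridVertex n 1 (n - 2)) fun c hc => ?_)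
    · exact hx ▸ adj_left (by omega) (by omega)
    · rw [hx]
      exact eq_of_adj_corner hn hc

variable {C : Type} {χ χ' : CFIVertex (baseGraph n) → CFIVertex (baseGraph n) → C}

/-- A stable pair for two twisted versions of the graph `X(G)` of the base graph. -/
abbrev TwistPair (t t' : Sym2 (Option (Fin 2 × Fin n)) → ZMod 2)
    (χ χ' : CFIVertex (baseGraph n) → CFIVertex (baseGraph n) → C) : Prop :=
  StablePair (twistGraph (baseGraph n) t) (twistGraph (baseGraph n) t') χ χ'

theorem TwistPair.twistDegree_eq (h : TwistPair t t' χ χ') {u u' : CFIVertex (baseGraph n)}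
    (e : χ u u = χ' u' u') : twistDegree t u = twistDegree t' u' :=
  StablePair.card_adj_eq h e

theorem TwistPair.leaf_iff (hn : 3 ≤ n) (h : TwistPair t t' χ χ')
    {u u' : CFIVertex (baseGraph n)} (e : χ u u = χ' u' u') : u.1 = none ↔ u'.1 = none := by
  have hd := h.twistDegree_eq e
  constructor
  · intro hu
    by_contra hu'
    have h1 := twistDegree_leaf_le (t := t) (by omega) hu
    have h2 := three_le_twistDegree (t := t') hn hu'
    omega
  · intro hu'
    by_contra hu
    have h1 := twistDegree_leaf_le (t := t') (by omega) hu'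
    have h2 := three_le_twistDegree (t := t) hn hu
    omega

theorem TwistPair.corner_of_adj_leaf (hn : 3 ≤ n) (h : TwistPair t t' χ χ')
    {u u' w : CFIVertex (baseGraph n)} (e : χ u u = χ' u' u')
    (hw : (twistGraph (baseGraph n) t).Adj u w) (hl : w.1 = none) :
    u'.1 = gridVertex n 0 (n - 1) := by
  obtain ⟨w', hw', ew⟩ := StablePair.exists_adj h e hw
  have := (h.leaf_iff hn ew).1 hl
  exact eq_of_adj_leaf (this ▸ hw'.1.symm)

theorem exists_adj_corner (hn : 3 ≤ n) {u : CFIVertex (baseGraph n)}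
    (hu : u.1 = gridVertex n 1 (n - 1)) :
    ∃ w l, (twistGraph (baseGraph n) t).Adj u w ∧ (twistGraph (baseGraph n) t).Adj w l ∧
      l.1 = none := by
  have hr : (baseGraph n).Adj u.1 (gridVertex n 0 (n - 1)) :=
    hu ▸ adj_rung (by omega) (by decide)
  have hl : (baseGraph n).Adj (gridVertex n 0 (n - 1)) none := adj_leaf (by omega)
  obtain ⟨l, hln⟩ := exists_vertex (G := baseGraph n) none
  obtain ⟨w, hw, hw1, hw2⟩ := exists_vertex_comp_comp hr.symm hl
    (adj_left (i := 0) (by omega) (by omega))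
    (hu ▸ gridVertex_ne_none (by omega)) (hu ▸ gridVertex_row_ne (by decide) (by omega))
    (gridVertex_ne_none (by omega)).symm
    (comp u (gridVertex n 0 (n - 1)) + t s(u.1, gridVertex n 0 (n - 1)))
    (comp l (gridVertex n 0 (n - 1)) + t s(none, gridVertex n 0 (n - 1)))
  refine ⟨w, l, adj_of_comp_eq (hw ▸ hr) (by rw [hw]; exact hw1), ?_, hln⟩
  refine (adj_of_comp_eq (by rw [hw, hln]; exact hl.symm) ?_ :
    (twistGraph (baseGraph n) t).Adj l w).symm
  rw [hw, hln]
  exact hw2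

/-- A path of length two to the pendant gadget leaves three candidates: the pendant vertex itself,
this corner, and `gridVertex n 0 (n - 2)`, whose degree is too large. -/
theorem TwistPair.corner (hn : 3 ≤ n) (h : TwistPair t t' χ χ')
    {u u' : CFIVertex (baseGraph n)} (e : χ u u = χ' u' u')
    (hu : u.1 = gridVertex n 1 (n - 1)) : u'.1 = gridVertex n 1 (n - 1) := by
  obtain ⟨w, l, hw, hwl, hl⟩ := exists_adj_corner (t := t) hn hu
  obtain ⟨w', hw', ew⟩ := StablePair.exists_adj h e hw
  have hwc := h.corner_of_adj_leaf hn ew hwl hl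
  rcases eq_of_adj_corner' hn (hwc ▸ hw'.1.symm) with h' | h' | h'
  · have := (h.leaf_iff hn e).2 h'
    exact (gridVertex_ne_none (by omega) (hu.symm.trans this)).elim
  · exact h'
  · have hd := h.twistDegree_eq e
    have h1 := twistDegree_corner_le (t := t) hn hu
    have h2 := five_le_twistDegree (t := t') hn h'
    omega

theorem TwistPair.corner' (hn : 3 ≤ n) (h : TwistPair t t' χ χ')
    {u u' : CFIVertex (baseGraph n)} (e : χ u u = χ' u' u')
    (hu : u.1 = gridVertex n 0 (n - 1)) : u'.1 = gridVertex n 0 (n - 1) := by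
  -- A vertex of this gadget need not see the pendant gadget, as its component there may have the
  -- wrong value. In that case its degree is at most three, which excludes the only alternative at
  -- the already recognized corner.
  by_cases hl : ∀ y, (twistGraph (baseGraph n) t).Adj u y → y.1 ≠ none
  · have hd := h.twistDegree_eq e
    have h1 := twistDegree_corner_le' hn hu hl
    have hc := one_le_card_gadgetNeighbors_grid (t := t) (x := u) (i := 1) (j := n - 1)
      (by omega) (by omega) (hu ▸ adj_rung (by omega) (by decide))
    obtain ⟨w, hw⟩ := Finset.card_pos.1 hc
    obtain ⟨hw, hwc⟩ := mem_gadgetNeighbors.1 hw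
    obtain ⟨w', hw', ew⟩ := StablePair.exists_adj h e hw
    rcases eq_of_adj_corner hn (h.corner hn ew hwc ▸ hw'.1.symm) with h' | h'
    · exact h'
    · have h2 := four_le_twistDegree (t := t') hn h'
      omega
  · push Not at hl
    obtain ⟨w, hw, hl⟩ := hl
    exact h.corner_of_adj_leaf hn e hw hl

/-- Induction on the distance from the last column. A neighbour of `u` in the recognized column `j +
1` leaves one position for `u'` that is not in a recognized column. The symmetric pair is used to
see that `u'` is not in such a column, hence the quantification over the colourings. -/
theorem TwistPair.grid (hn : 3 ≤ n) {j : ℕ} (hj : j < n) :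
    ∀ {t t' : Sym2 (Option (Fin 2 × Fin n)) → ZMod 2}
      {χ χ' : CFIVertex (baseGraph n) → CFIVertex (baseGraph n) → C}, TwistPair t t' χ χ' →
      ∀ {u u' : CFIVertex (baseGraph n)}, χ u u = χ' u' u' →
      ∀ i, u.1 = gridVertex n i j → u'.1 = gridVertex n i j := by
  obtain ⟨d, hd⟩ : ∃ d, d + j = n - 1 := ⟨n - 1 - j, by omega⟩
  induction d using Nat.strong_induction_on generalizing j with
  | _ d ih =>
    intro t t' χ χ' h u u' e i hu
    rcases d with _ | d
    · obtain rfl : j = n - 1 := by omega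
      fin_cases i
      · exact h.corner' hn e hu
      · exact h.corner hn e hu
    · have pinned : ∀ k, j < k → ∀ i', u'.1 ≠ gridVertex n i' k := by
        intro k hk i' hu'
        by_cases hkn : k < n
        · have := ih (n - 1 - k) (by omega) hkn (by omega) (StablePair.symm h) e.symm i' hu'
          rw [hu, gridVertex_eq_iff hj] at this
          omega
        · rw [gridVertex_of_le (by omega)] at hu'
          have := (h.leaf_iff hn e).2 hu'
          exact gridVertex_ne_none hj (hu.symm.trans this)
      have hc := one_le_card_gadgetNeighbors_grid (t := t) (x := u) (i := i) (j := j + 1)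
        (by omega) (by omega) (hu ▸ adj_succ (by omega))
      obtain ⟨w, hw⟩ := Finset.card_pos.1 hc
      obtain ⟨hw, hwc⟩ := mem_gadgetNeighbors.1 hw
      obtain ⟨w', hw', ew⟩ := StablePair.exists_adj h e hw
      have hw1 := ih d (by omega) (by omega) (by omega) h ew i hwc
      obtain ⟨i', hi⟩ := exists_other_row i
      rcases eq_of_adj_gridVertex hi (by omega) (hw1 ▸ hw'.1.symm) with h' | h' | ⟨-, h'⟩
      · exact (pinned _ (by omega) _ h').elim
      · exact (pinned _ (by omega) _ h').elim
      · exact h'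

end Pin

/-! ### Sweeping through the ladder -/

section Sweep

variable {n : ℕ} {C : Type} {t t' : Sym2 (Option (Fin 2 × Fin n)) → ZMod 2}
  {χ χ' : CFIVertex (baseGraph n) → CFIVertex (baseGraph n) → C}

/-- The components in which the vertices `x` and `y` differ. -/
def compDiff (x y : CFIVertex (baseGraph n)) (r : Option (Fin 2 × Fin n)) : ZMod 2 :=
  comp x r + comp y r

theorem comp_leaf {x : CFIVertex (baseGraph n)} (hx : x.1 = none) (r : Option (Fin 2 × Fin n)) :
    comp x r = 0 := by
  have hne : ∀ r, r ≠ gridVertex n 0 (n - 1) → comp x r = 0 := fun r hr =>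
    comp_of_not_adj fun h => hr (eq_of_adj_leaf (hx ▸ h))
  by_cases hr : r = gridVertex n 0 (n - 1)
  · rw [← sum_comp x, Finset.sum_eq_single (gridVertex n 0 (n - 1)) (fun r _ h => hne r h)
      (by simp), hr]
  · exact hne r hr

theorem comp_grid {x : CFIVertex (baseGraph n)} {i i' : Fin 2} (hi : i ≠ i') {j : ℕ} (hj : j < n)
    (hx : x.1 = gridVertex n i j) :
    comp x (gridVertex n i' j) + (comp x (gridVertex n i (j + 1)) +
      comp x (gridVertex n i (j - 1))) = 0 := by
  -- At the ends of the ladder, missing neighbours do no harm: for `j = 0` the left one is `x.1`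
  -- itself, and past the last column it is `none`; components of nonadjacent base vertices are
  -- zero.
  rw [← sum_comp x, ← Finset.sum_pair (gridVertex_succ_ne_pred hj), ← Finset.sum_insert]
  · refine Finset.sum_subset (Finset.subset_univ _) fun r _ hr => comp_of_not_adj fun h => hr ?_
    have := eq_of_adj_gridVertex hi hj (hx ▸ h)
    simp only [Finset.mem_insert, Finset.mem_singleton]
    tauto
  · simp [gridVertex_eq_iff hj, hi.symm]

theorem compDiff_grid {x y : CFIVertex (baseGraph n)} {i i' : Fin 2} (hi : i ≠ i') {j : ℕ}
    (hj : j < n) (hx : x.1 = gridVertex n i j) (hy : y.1 = gridVertex n i j) :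
    compDiff x y (gridVertex n i' j) + (compDiff x y (gridVertex n i (j + 1)) +
      compDiff x y (gridVertex n i (j - 1))) = 0 := by
  have h1 := comp_grid hi hj hx
  have h2 := comp_grid hi hj hy
  unfold compDiff
  linear_combination h1 + h2

theorem compDiff_add_compDiff (h : TwistPair t t' χ χ') {u v u' v' : CFIVertex (baseGraph n)}
    (e : χ u v = χ' u' v') {p q : Option (Fin 2 × Fin n)} (hu : u.1 = p) (hu' : u'.1 = p)
    (hv : v.1 = q) (hv' : v'.1 = q) (hpq : (baseGraph n).Adj p q) :
    compDiff u u' q + compDiff v v' p = (t + t') s(p, q) := by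
  have h1 : (baseGraph n).Adj u.1 v.1 ∧ comp u v.1 + comp v u.1 = t s(u.1, v.1) ↔
    (baseGraph n).Adj u'.1 v'.1 ∧ comp u' v'.1 + comp v' u'.1 = t' s(u'.1, v'.1) :=
    StablePair.adj_iff h e
  rw [hu, hu', hv, hv', and_iff_right hpq, and_iff_right hpq] at h1
  unfold compDiff
  rw [Pi.add_apply]
  generalize comp u q = a at *
  generalize comp u' q = a' at *
  generalize comp v p = b at *
  generalize comp v' p = b' at *
  generalize t s(p, q) = c at *
  generalize t' s(p, q) = c' at *
  clear hu hu' hv hv' e h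
  revert a a' b b' c c'
  decide

/-- The sum of `s` over the edges of the grid in the columns `0, …, j`. -/
def twistSum (n : ℕ) (s : Sym2 (Option (Fin 2 × Fin n)) → ZMod 2) : ℕ → ZMod 2
  | 0 => s s(gridVertex n 0 0, gridVertex n 1 0)
  | j + 1 => twistSum n s j + s s(gridVertex n 0 j, gridVertex n 0 (j + 1)) +
      s s(gridVertex n 1 j, gridVertex n 1 (j + 1)) +
      s s(gridVertex n 0 (j + 1), gridVertex n 1 (j + 1))

theorem comp_eq_zero_of_eq {x : CFIVertex (baseGraph n)} : comp x x.1 = 0 :=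
  comp_of_not_adj (SimpleGraph.irrefl _)

/-- Induction over the columns: summing the parity conditions of the gadgets and the balance on the
edges cancels all interior components, leaving the two edges to the right and the twists passed. -/
theorem compDiff_column (hn : 3 ≤ n) (h : TwistPair t t' χ χ') {j : ℕ} (hj : j < n) :
    ∀ {u v u' v' : CFIVertex (baseGraph n)}, χ u v = χ' u' v' → u.1 = gridVertex n 0 j →
      v.1 = gridVertex n 1 j →
      compDiff u u' (gridVertex n 0 (j + 1)) + compDiff v v' (gridVertex n 1 (j + 1)) =
        twistSum n (t + t') j := by
  induction j with
  | zero =>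
    intro u v u' v' e hu hv
    have hu' := h.grid hn hj (StablePair.loop_left h e) 0 hu
    have hv' := h.grid hn hj (StablePair.loop_right h e) 1 hv
    have h1 := compDiff_grid (i' := 1) (by decide) hj hu hu'
    have h2 := compDiff_grid (i' := 0) (by decide) hj hv hv'
    have h3 := compDiff_add_compDiff h e hu hu' hv hv' (adj_rung hj (by decide))
    have h4 : compDiff u u' (gridVertex n 0 (0 - 1)) = 0 := by
      rw [compDiff, Nat.zero_sub, ← hu, comp_eq_zero_of_eq, hu, ← hu', comp_eq_zero_of_eq,
        add_zero]
    have h5 : compDiff v v' (gridVertex n 1 (0 - 1)) = 0 := by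
      rw [compDiff, Nat.zero_sub, ← hv, comp_eq_zero_of_eq, hv, ← hv', comp_eq_zero_of_eq,
        add_zero]
    unfold twistSum
    linear_combination h1 + h2 - h4 - h5 + h3 -
      CharTwo.add_self_eq_zero (compDiff u u' (gridVertex n 1 0)) -
      CharTwo.add_self_eq_zero (compDiff v v' (gridVertex n 0 0))
  | succ j ih =>
    intro u v u' v' e hu hv
    have hj' : j < n := by omega
    obtain ⟨w, hw⟩ := exists_vertex (G := baseGraph n) (gridVertex n 0 j)
    obtain ⟨z, hz⟩ := exists_vertex (G := baseGraph n) (gridVertex n 1 j)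
    -- Pebbles on `u`, `v` are moved to `w`, `z` one at a time: once `w` is placed, `u` is given up
    -- and `z` is placed between `w` and `v`.
    obtain ⟨w', ew, ew'⟩ := StablePair.exists_between h e w
    obtain ⟨z', ez, ez'⟩ := StablePair.exists_between h ew' z
    have hu' := h.grid hn hj (StablePair.loop_left h e) 0 hu
    have hv' := h.grid hn hj (StablePair.loop_right h e) 1 hv
    have hw' := h.grid hn hj' (StablePair.loop_left h ew') 0 hw
    have hz' := h.grid hn hj' (StablePair.loop_left h ez') 1 hz
    have h0 := ih hj' ez hw hz
    have h1 := compDiff_grid (i' := 1) (by decide) hj hu hu'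
    have h2 := compDiff_grid (i' := 0) (by decide) hj hv hv'
    have h3 := compDiff_add_compDiff h e hu hu' hv hv' (adj_rung hj (by decide))
    have h4 := compDiff_add_compDiff h ew hu hu' hw hw' (adj_succ hj).symm
    have h5 := compDiff_add_compDiff h ez' hz hz' hv hv' (adj_succ hj)
    rw [Sym2.eq_swap] at h4
    rw [Nat.add_sub_cancel] at h1 h2
    unfold twistSum
    linear_combination (exp := 1) h0 + h1 + h2 + h3 + h4 + h5 -
      CharTwo.add_self_eq_zero (compDiff u u' (gridVertex n 1 (j + 1))) -
      CharTwo.add_self_eq_zero (compDiff v v' (gridVertex n 0 (j + 1))) -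
      CharTwo.add_self_eq_zero (compDiff u u' (gridVertex n 0 j)) -
      CharTwo.add_self_eq_zero (compDiff v v' (gridVertex n 1 j)) -
      CharTwo.add_self_eq_zero (compDiff w w' (gridVertex n 0 (j + 1))) -
      CharTwo.add_self_eq_zero (compDiff z z' (gridVertex n 1 (j + 1)))

theorem TwistPair.twistSum_eq_zero (hn : 3 ≤ n) (h : TwistPair t t' χ χ') :
    twistSum n (t + t') (n - 1) + (t + t') s(gridVertex n 0 (n - 1), none) = 0 := by
  have hj : n - 1 < n := by omega
  obtain ⟨u, hu⟩ := exists_vertex (G := baseGraph n) (gridVertex n 0 (n - 1))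
  obtain ⟨v, hv⟩ := exists_vertex (G := baseGraph n) (gridVertex n 1 (n - 1))
  obtain ⟨l, hl⟩ := exists_vertex (G := baseGraph n) none
  obtain ⟨u', v', e⟩ := StablePair.left h u v
  obtain ⟨l', el, -⟩ := StablePair.exists_between h e l
  have hu' := h.grid hn hj (StablePair.loop_left h e) 0 hu
  have hv' := h.grid hn hj (StablePair.loop_right h e) 1 hv
  have hl' := (h.leaf_iff hn (StablePair.loop_right h el)).1 hl
  have h1 := compDiff_column hn h hj e hu hv
  have h2 := compDiff_add_compDiff h el hu hu' hl hl' (adj_leaf (by omega))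
  have h3 : compDiff l l' (gridVertex n 0 (n - 1)) = 0 := by
    rw [compDiff, comp_leaf hl, comp_leaf hl', add_zero]
  have hnone : ¬ (baseGraph n).Adj (gridVertex n 1 (n - 1)) none := fun hadj =>
    gridVertex_row_ne (i := 1) (i' := 0) (by decide) hj (eq_of_adj_leaf hadj.symm)
  have h4 : compDiff v v' none = 0 := by
    rw [compDiff, comp_of_not_adj (by rwa [hv]), comp_of_not_adj (by rwa [hv']), add_zero]
  rw [gridVertex_of_le (by omega), gridVertex_of_le (by omega), h4, add_zero] at h1
  rw [← h1, ← h2, h3, add_zero, CharTwo.add_self_eq_zero]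

/-! ### The total twist of a single edge -/

theorem edge_cases (e : (baseGraph n).edgeSet) :
    e.1 = s(gridVertex n 0 (n - 1), none) ∨
    (∃ j, j < n ∧ e.1 = s(gridVertex n 0 j, gridVertex n 1 j)) ∨
    ∃ i j, j + 1 < n ∧ e.1 = s(gridVertex n i j, gridVertex n i (j + 1)) := by
  obtain ⟨e, he⟩ := e
  induction e with | _ p q =>
  have hadj : (baseGraph n).Adj p q := he
  rcases eq_none_or_gridVertex p with rfl | ⟨i, j, hj, rfl⟩
  · obtain rfl := eq_of_adj_leaf hadj
    exact Or.inl Sym2.eq_swap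
  · obtain ⟨i', hi⟩ := exists_other_row i
    rcases eq_of_adj_gridVertex hi hj hadj with rfl | rfl | ⟨h1, rfl⟩
    · refine Or.inr (Or.inl ⟨j, hj, ?_⟩)
      fin_cases i <;> fin_cases i'
      · exact (hi rfl).elim
      · rfl
      · exact Sym2.eq_swap
      · exact (hi rfl).elim
    · by_cases hj' : j + 1 < n
      · exact Or.inr (Or.inr ⟨i, j, hj', rfl⟩)
      · have hnone : gridVertex n i (j + 1) = none := gridVertex_of_le (by omega)
        rw [hnone] at hadj
        refine Or.inl ?_
        change s(gridVertex n i j, gridVertex n i (j + 1)) = _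
        rw [hnone, eq_of_adj_leaf hadj.symm]
    · refine Or.inr (Or.inr ⟨i, j - 1, by omega, ?_⟩)
      rw [Nat.sub_add_cancel h1]
      exact Sym2.eq_swap

theorem twistSum_edgeIndicator_leaf {j : ℕ} (hj : j < n) :
    twistSum n (edgeIndicator s(gridVertex n 0 (n - 1), none)) j = 0 := by
  have key : ∀ {i i' : Fin 2} {k k' : ℕ}, k < n → k' < n →
      edgeIndicator s(gridVertex n 0 (n - 1), none) s(gridVertex n i k, gridVertex n i' k') = 0 := by
    intro i i' k k' hk hk'
    simp [edgeIndicator, gridVertex_ne_none hk, gridVertex_ne_none hk']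
  induction j with
  | zero => exact key hj hj
  | succ j ih =>
    rw [twistSum, ih (by omega), key (by omega) hj, key (by omega) hj, key hj hj]
    simp

theorem edgeIndicator_grid {i₁ i₂ i₃ i₄ : Fin 2} {j₁ j₂ j₃ j₄ : ℕ} (h₁ : j₁ < n) (h₂ : j₂ < n) :
    edgeIndicator s(gridVertex n i₁ j₁, gridVertex n i₂ j₂)
      s(gridVertex n i₃ j₃, gridVertex n i₄ j₄) =
      if (i₁ = i₃ ∧ j₁ = j₃) ∧ (i₂ = i₄ ∧ j₂ = j₄) ∨ (i₁ = i₄ ∧ j₁ = j₄) ∧ (i₂ = i₃ ∧ j₂ = j₃)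
      then 1 else 0 := by
  unfold edgeIndicator
  refine if_congr ?_ rfl rfl
  rw [eq_comm, Sym2.eq_iff, gridVertex_eq_iff h₁, gridVertex_eq_iff h₂, gridVertex_eq_iff h₁,
    gridVertex_eq_iff h₂]

theorem twistSum_edgeIndicator_rung {k : ℕ} (hk : k < n) (j : ℕ) :
    twistSum n (edgeIndicator s(gridVertex n 0 k, gridVertex n 1 k)) j =
      if k ≤ j then 1 else 0 := by
  induction j with
  | zero =>
    rw [twistSum, edgeIndicator_grid hk hk]
    simp
  | succ j ih =>
    rw [twistSum, ih, edgeIndicator_grid hk hk, edgeIndicator_grid hk hk, edgeIndicator_grid hk hk]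
    rcases lt_trichotomy k (j + 1) with h | h | h
    · simp [show k ≤ j by omega, show k ≤ j + 1 by omega, h.ne]
    · simp [h]
    · simp [show ¬ k ≤ j by omega, show ¬ k ≤ j + 1 by omega, h.ne']

theorem twistSum_edgeIndicator_succ {i : Fin 2} {k : ℕ} (hk : k + 1 < n) (j : ℕ) :
    twistSum n (edgeIndicator s(gridVertex n i k, gridVertex n i (k + 1))) j =
      if k < j then 1 else 0 := by
  have hk' : k < n := by omega
  induction j with
  | zero =>
    rw [twistSum, edgeIndicator_grid hk' hk]
    simp
  | succ j ih =>
    rw [twistSum, ih, edgeIndicator_grid hk' hk, edgeIndicator_grid hk' hk,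
      edgeIndicator_grid hk' hk]
    rcases lt_trichotomy k j with h | h | h
    · simp [show k < j + 1 by omega, h, h.ne, show k ≠ j + 1 by omega]
    · subst h
      fin_cases i <;> simp
    · simp [show ¬ k < j by omega, show ¬ k < j + 1 by omega, h.ne']
      rw [if_neg (by omega), if_neg (by omega), add_zero]

theorem twistSum_edgeIndicator (hn : 1 ≤ n) (e : (baseGraph n).edgeSet) :
    twistSum n (edgeIndicator e.1) (n - 1) +
      edgeIndicator e.1 s(gridVertex n 0 (n - 1), none) = 1 := by
  have hne : ∀ {p q : Option (Fin 2 × Fin n)}, p ≠ none → q ≠ none →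
      edgeIndicator s(p, q) s(gridVertex n 0 (n - 1), none) = 0 := fun hp hq => by
    simp [edgeIndicator, hp.symm, hq.symm]
  rcases edge_cases e with h | ⟨j, hj, h⟩ | ⟨i, j, hj, h⟩ <;> rw [h]
  · rw [twistSum_edgeIndicator_leaf (by omega), edgeIndicator, if_pos rfl, zero_add]
  · rw [twistSum_edgeIndicator_rung hj, if_pos (by omega),
      hne (gridVertex_ne_none hj) (gridVertex_ne_none hj), add_zero]
  · rw [twistSum_edgeIndicator_succ hj, if_pos (by omega),
      hne (gridVertex_ne_none (by omega)) (gridVertex_ne_none hj), add_zero]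

theorem not_stablePair (hn : 3 ≤ n) (e : (baseGraph n).edgeSet) :
    ¬ StablePair (cfi (baseGraph n)) (cfiTwisted (baseGraph n) e) χ χ' := by
  rw [cfi_eq_twistGraph, cfiTwisted_eq_twistGraph]
  intro h
  have := TwistPair.twistSum_eq_zero hn h
  rw [zero_add, twistSum_edgeIndicator (by omega)] at this
  exact one_ne_zero this

end Sweep

/-! ### Numbers of iterations and of vertices -/

section Main

variable {n : ℕ}

theorem distinguishesIn_of_samePartition (hn : 3 ≤ n) (e : (baseGraph n).edgeSet)
    {H : SimpleGraph (CFIVertex (baseGraph n))}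
    (hH : H = cfi (baseGraph n) ∨ H = cfiTwisted (baseGraph n) e) {m : ℕ}
    (hs : SamePartition (walkIterate H m) (walkIterate H (m + 1))) :
    DistinguishesIn walkRefinement (m + 1) (cfi (baseGraph n))
      (cfiTwisted (baseGraph n) e) := by
  rcases hH with rfl | rfl
  · exact by_contra fun hd => not_stablePair hn e (stablePair_of_samePartition hs hd)
  · exact by_contra fun hd => not_stablePair hn e
      (stablePair_of_samePartition hs fun h => hd h.symm).symm

theorem exists_adj_of_grid {t : Sym2 (Option (Fin 2 × Fin n)) → ZMod 2} (hn : 2 ≤ n)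
    {x : CFIVertex (baseGraph n)} {i : Fin 2} {j : ℕ} (hj : j < n)
    (h : (baseGraph n).Adj x.1 (gridVertex n i j)) :
    ∃ y, (twistGraph (baseGraph n) t).Adj x y ∧ y.1 = gridVertex n i j := by
  obtain ⟨y, hy⟩ := Finset.card_pos.1 (one_le_card_gadgetNeighbors_grid (t := t) hn hj h)
  exact ⟨y, mem_gadgetNeighbors.1 hy⟩

/-- The pendant vertex `x` has a common neighbour with some `z` in column `n - 2` but none with a
vertex `w` in column `0`, although both pairs are initially nonadjacent and distinct. -/
theorem not_samePartition_zero (hn : 3 ≤ n) (t : Sym2 (Option (Fin 2 × Fin n)) → ZMod 2) :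
    ¬ SamePartition (walkIterate (twistGraph (baseGraph n) t) 0)
      (walkIterate (twistGraph (baseGraph n) t) 1) := by
  intro hs
  obtain ⟨x, hx⟩ := exists_vertex (G := baseGraph n) none
  obtain ⟨y, hxy, hy⟩ := exists_adj_of_grid (t := t) (x := x) (i := 0) (j := n - 1)
    (by omega) (by omega) (hx ▸ (adj_leaf (by omega)).symm)
  obtain ⟨z, hyz, hz⟩ := exists_adj_of_grid (t := t) (x := y) (i := 0) (j := n - 1 - 1)
    (by omega) (by omega) (hy ▸ adj_left (by omega) (by omega))
  obtain ⟨w, hw⟩ := exists_vertex (G := baseGraph n) (gridVertex n 0 0)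
  have far : ∀ {v : CFIVertex (baseGraph n)} {j : ℕ}, v.1 = gridVertex n 0 j → j + 1 < n →
      ¬ (twistGraph (baseGraph n) t).Adj x v := by
    intro v j hv hj hadj
    have h1 := eq_of_adj_leaf (hx ▸ hadj.1)
    rw [hv, gridVertex_eq_iff (by omega)] at h1
    omega
  have hne : ∀ {v : CFIVertex (baseGraph n)} {j : ℕ}, v.1 = gridVertex n 0 j → j < n →
      x ≠ v := by
    rintro v j hv hj rfl
    exact gridVertex_ne_none hj (hv.symm.trans hx)
  have hcol : initialColouring (twistGraph (baseGraph n) t) x z =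
      initialColouring (twistGraph (baseGraph n) t) x w :=
    initialColouring_eq (iff_of_false (hne hz (by omega)) (hne hw (by omega)))
      (iff_of_false (far hz (by omega)) (far hw (by omega)))
  have hk := kWalkRefinement_eq_of_walkIterate_succ_eq (m := 0) (hs.1 _ _ _ _ hcol)
    one_le_two le_rfl
  change kWalkRefinement 2 _ _ (initialColouring _) x z =
    kWalkRefinement 2 _ _ (initialColouring _) x w at hk
  rw [kWalkRefinement_two, kWalkRefinement_two] at hk
  have hm := Multiset.mem_map_of_mem (fun v =>
    [initialColouring (twistGraph (baseGraph n) t) x v,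
      initialColouring (twistGraph (baseGraph n) t) v z]) (Finset.mem_univ y)
  rw [hk] at hm
  obtain ⟨v, -, hv⟩ := Multiset.mem_map.1 hm
  simp only [List.cons.injEq, and_true] at hv
  have h1 := (adj_iff_of_initialColouring_eq hv.1).2 hxy
  have h2 := (adj_iff_of_initialColouring_eq hv.2).2 hyz
  have h3 := eq_of_adj_leaf (hx ▸ h1.1)
  rcases eq_of_adj_gridVertex (i' := 1) (by decide) (by omega) (hw ▸ h2.1.symm) with h | h | ⟨h, -⟩
  · rw [h3, gridVertex_eq_iff (by omega)] at h
    omega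
  · rw [h3, gridVertex_eq_iff (by omega)] at h
    omega
  · omega

theorem iterationNumber_bound (hn : 3 ≤ n) (e : (baseGraph n).edgeSet)
    {H : SimpleGraph (CFIVertex (baseGraph n))}
    (hH : H = cfi (baseGraph n) ∨ H = cfiTwisted (baseGraph n) e) :
    n ≤ 9 * iterationNumber walkRefinement H := by
  have hs := samePartition_iterationNumber H
  have hd := distinguishesIn_of_samePartition hn e hH hs
  have h1 : ¬ 4 * (iterationNumber walkRefinement H + 1) + 2 ≤ n := fun hle =>
    not_distinguishesIn_of_le walkRefinement_isWalkOperator hle e hd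
  have h0 : iterationNumber walkRefinement H ≠ 0 := by
    intro h0
    rw [h0] at hs
    rcases hH with rfl | rfl
    · rw [cfi_eq_twistGraph] at hs
      exact not_samePartition_zero hn _ hs
    · rw [cfiTwisted_eq_twistGraph] at hs
      exact not_samePartition_zero hn _ hs
  -- Stability after `m` iterations gives `n ≤ 4 * m + 5`, and `m ≥ 1` turns this into `n ≤ 9 * m`;
  -- without it, small `n` would escape a purely multiplicative bound.
  omega

theorem le_card_cfiVertex : n ≤ Fintype.card (CFIVertex (baseGraph n)) := by
  choose f hf using exists_vertex (G := baseGraph n)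
  have := Fintype.card_le_of_injective f (Function.LeftInverse.injective (g := Sigma.fst) hf)
  simp only [Fintype.card_option, Fintype.card_prod, Fintype.card_fin] at this
  omega

theorem card_gadget_le (p : Option (Fin 2 × Fin n)) :
    Fintype.card (Gadget (baseGraph n) p) ≤ 8 := by
  have hdeg : Fintype.card ((baseGraph n).neighborSet p) ≤ 3 := by
    obtain ⟨a, b, c, h⟩ : ∃ a b c, ∀ q, (baseGraph n).Adj p q → q = a ∨ q = b ∨ q = c := by
      rcases eq_none_or_gridVertex p with rfl | ⟨i, j, hj, rfl⟩
      · exact ⟨_, none, none, fun q hq => Or.inl (eq_of_adj_leaf hq)⟩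
      · obtain ⟨i', hi⟩ := exists_other_row i
        refine ⟨gridVertex n i' j, gridVertex n i (j + 1), gridVertex n i (j - 1), fun q hq => ?_⟩
        have := eq_of_adj_gridVertex hi hj hq
        tauto
    refine (Fintype.card_of_subtype (p := fun q => q ∈ (baseGraph n).neighborSet p)
      (Finset.univ.filter ((baseGraph n).Adj p)) (by simp)).trans_le ?_
    refine (Finset.card_le_card (t := {a, b, c}) fun q hq => ?_).trans Finset.card_le_three
    simpa using h q (by simpa using hq)
  refine (Fintype.card_subtype_le _).trans ?_
  rw [Fintype.card_fun, Fintype.card_bool]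
  exact Nat.pow_le_pow_right two_pos hdeg

theorem card_cfiVertex_le (hn : 1 ≤ n) : Fintype.card (CFIVertex (baseGraph n)) ≤ 24 * n := by
  rw [Fintype.card_sigma]
  -- There are `2 * n + 1 ≤ 3 * n` gadgets with at most `2 ^ 3` vertices each.
  refine (Finset.sum_le_card_nsmul _ _ 8 fun p _ => card_gadget_le p).trans ?_
  simp
  omega

end Main

end WalkRef

theorem mainTheorem7 :
    ∃ c C : ℝ, 0 < c ∧ 0 < C ∧
      ∀ (n : ℕ), 3 ≤ n → ∀ (e : (WalkRef.baseGraph n).edgeSet),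
        -- the graphs have linearly many vertices
        (c * n ≤ (Fintype.card (WalkRef.CFIVertex (WalkRef.baseGraph n)) : ℝ) ∧
          (Fintype.card (WalkRef.CFIVertex (WalkRef.baseGraph n)) : ℝ) ≤ C * n) ∧
        -- walk refinement distinguishes them, but only after linearly many iterations
        ((∃ m : ℕ, WalkRef.DistinguishesIn WalkRef.walkRefinement m
            (WalkRef.cfi (WalkRef.baseGraph n)) (WalkRef.cfiTwisted (WalkRef.baseGraph n) e)) ∧
          ∀ m : ℕ, WalkRef.DistinguishesIn WalkRef.walkRefinement m
            (WalkRef.cfi (WalkRef.baseGraph n)) (WalkRef.cfiTwisted (WalkRef.baseGraph n) e) →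
            c * n ≤ m) ∧
        -- the same bound when one common walk length is used for both graphs
        (∀ k : ℕ, 2 ≤ k → ∀ m : ℕ, WalkRef.DistinguishesIn (WalkRef.kWalkRefinement k) m
            (WalkRef.cfi (WalkRef.baseGraph n)) (WalkRef.cfiTwisted (WalkRef.baseGraph n) e) →
            c * n ≤ m) ∧
        -- on each of the two graphs walk refinement stabilizes only after linearly many iterations
        (∀ H : SimpleGraph (WalkRef.CFIVertex (WalkRef.baseGraph n)),
          H = WalkRef.cfi (WalkRef.baseGraph n) ∨
            H = WalkRef.cfiTwisted (WalkRef.baseGraph n) e →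
          c * n ≤ WalkRef.iterationNumber WalkRef.walkRefinement H ∧
            c * (Fintype.card (WalkRef.CFIVertex (WalkRef.baseGraph n)) : ℝ) ≤
              WalkRef.iterationNumber WalkRef.walkRefinement H) := by
  -- The constant `216 = 9 * 24` combines `n ≤ 9 * m` for the iteration number `m` with at most `24
  -- * n` vertices.
  refine ⟨1 / 216, 24, by norm_num, by norm_num, fun n hn e => ?_⟩
  have hcard : (Fintype.card (WalkRef.CFIVertex (WalkRef.baseGraph n)) : ℝ) ≤ 24 * n := by
    exact_mod_cast WalkRef.card_cfiVertex_le (by omega)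
  have hcard' : (n : ℝ) ≤ Fintype.card (WalkRef.CFIVertex (WalkRef.baseGraph n)) := by
    exact_mod_cast WalkRef.le_card_cfiVertex
  have hn0 : (0 : ℝ) ≤ n := Nat.cast_nonneg n
  have hlow : ∀ {r : WalkRef.ColouringOperator}, WalkRef.IsWalkOperator r → ∀ m : ℕ,
      WalkRef.DistinguishesIn r m (WalkRef.cfi (WalkRef.baseGraph n))
        (WalkRef.cfiTwisted (WalkRef.baseGraph n) e) → 1 / 216 * (n : ℝ) ≤ m := by
    intro r hr m hd
    have h1 : ¬ 4 * m + 2 ≤ n := fun hle => WalkRef.not_distinguishesIn_of_le hr hle e hd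
    have h2 : (n : ℝ) ≤ 216 * m := by
      exact_mod_cast (by omega : n ≤ 216 * m)
    linarith
  refine ⟨⟨by linarith, hcard⟩, ⟨?_, hlow WalkRef.walkRefinement_isWalkOperator⟩,
    fun k _ => hlow (WalkRef.kWalkRefinement_isWalkOperator k), fun H hH => ?_⟩
  · obtain ⟨m, hm⟩ := WalkRef.exists_samePartition_walkIterate
      (WalkRef.cfi (WalkRef.baseGraph n))
    exact ⟨m + 1, WalkRef.distinguishesIn_of_samePartition hn e (Or.inl rfl) hm⟩
  · have h : (n : ℝ) ≤ 9 * WalkRef.iterationNumber WalkRef.walkRefinement H := by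
      exact_mod_cast WalkRef.iterationNumber_bound hn e hH
    constructor <;> linarith
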